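/- All C*-algebras and *-homomorphisms are unital. A Boolean σ-algebra is a Boolean algebra with countable suprema and infima; it need not be an algebra of sets. A σ-homomorphism of Boolean σ-algebras is a Boolean homomorphism preserving countable suprema. A $\sigma C^*$-algebra is a C*-algebra $\mathcal A$ in which every norm-bounded increasing sequence of self-adjoint elements has a supremum in $\mathcal A_{\mathrm{sa}}$. A positive linear map $\phi$ between C*-algebras is σ-normal if $\phi(a)=\sup_n\phi(a_n)$ whenever $(a_n)$ is a norm-bounded increasing sequence of self-adjoint elements with supremum $a$ among the self-adjoint elements; a σ-cpu map is a completely positive unital σ-normal map, and a σ-homomorphism of C*-algebras is a σ-normal $*$-homomorphism. For a Boolean σ-algebra $B$, let $\mathscr L^\infty_{\mathrm{abs}}(B)$ be the set of σ-homomorphisms $f$ from the Borel σ-algebra of $\mathbb C$ to $B$ such that $f(U)=\top$ for some bounded Borel set $U$. It is a commutative C*-algebra as follows. For $f,g$ let $\langle f,g\rangle$ be the unique σ-homomorphism from the Borel σ-algebra of $\mathbb C^2$ to $B$ with $\langle f,g\rangle(U\times V)=f(U)\wedge g(V)$; then $(f+g)(U)=\langle f,g\rangle(\{(z,w): z+w\in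 U\})$, $(fg)(U)=\langle f,g\rangle(\{(z,w): zw\in U\})$, $(\lambda f)(U)=f(\{z:\lambda z\in U\})$, $f^*(U)=f(\{z:\bar z\in U\})$ and $\|f\|=\inf\{r\ge 0: f(\{|z|\le r\})=\top\}$. For $p\in B$ let $\chi_p\in\mathscr L^\infty_{\mathrm{abs}}(B)$ be the element with $\chi_p(\{1\})=p$ and $\chi_p(\{0\})=\neg p$. For a $\sigma C^*$-algebra $\mathcal A$, an $\mathcal A$-valued POVM on $B$ is a map $\mu:B\to\mathcal A$ with $\mu(p)\ge 0$ for all $p$, $\mu(\top)=1$, and $\mu(\sup_n p_n)=\sum_n\mu(p_n)$ for every sequence of pairwise disjoint elements, where the sum is the supremum of the finite partial sums. It is a PVM if moreover $\mu(p\wedge q)=\mu(p)\mu(q)$ for all $p,q$. **Theorem.** Let $B$ be a Boolean σ-algebra and $\mathcal A$ a $\sigma C^*$-algebra. 1. For every POVM $\mu:B\to\mathcal A$ there is a unique σ-cpu map $\phi:\mathscr L^\infty_{\mathrm{abs}}(B)\to\mathcal A$ with $\phi(\chi_p)=\mu(p)$ for all $p\in B$, and every positive linear map $\psi$ with $\psi(\chi_p)=\mu(p)$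 for all $p$ equals $\phi$. Conversely, for every σ-cpu map $\phi$, the map $p\mapsto\phi(\chi_p)$ is a POVM. 2. For every PVM $\mu:B\to\mathcal A$ there is a unique σ-homomorphism $\phi:\mathscr L^\infty_{\mathrm{abs}}(B)\to\mathcal A$ with $\phi(\chi_p)=\mu(p)$ for all $p\in B$, and every positive linear map $\psi$ with $\psi(\chi_p)=\mu(p)$ for all $p$ equals $\phi$. Conversely, for every σ-homomorphism $\phi$, the map $p\mapsto\phi(\chi_p)$ is a PVM. -/

import Mathlib

open Set Filter Topology
open scoped CStarAlgebra

noncomputable section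

namespace PovmIntegration

universe u v w

/-! # Boolean σ-algebras and σ-homomorphisms -/

/-- A Boolean σ-algebra: a Boolean algebra with countable suprema and infima. -/
class IsBooleanSigmaAlgebra (B : Type u) [BooleanAlgebra B] : Prop where
  exists_isLUB : ∀ p : ℕ → B, ∃ s, IsLUB (range p) s
  exists_isGLB : ∀ p : ℕ → B, ∃ s, IsGLB (range p) s

/-- A σ-homomorphism of Boolean σ-algebras: a Boolean algebra homomorphism preserving suprema of
sequences. (A bounded lattice homomorphism between Boolean algebras preserves complements.) -/
structure SigmaHom (A : Type u) (B : Type v) [BooleanAlgebra A] [BooleanAlgebra B] extends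
    BoundedLatticeHom A B where
  map_isLUB' : ∀ (p : ℕ → A) (s : A), IsLUB (range p) s →
    IsLUB (range fun n => toFun (p n)) (toFun s)

/-- The Boolean σ-algebra of measurable sets of a measurable space. -/
abbrev MSet (Y : Type u) [MeasurableSpace Y] : Type u := Subtype (MeasurableSet : Set Y → Prop)

section SigmaHomBasics

variable {A : Type u} {B : Type v} {C : Type w} [BooleanAlgebra A] [BooleanAlgebra B]
  [BooleanAlgebra C] {Y Z : Type*} [MeasurableSpace Y] [MeasurableSpace Z]

instance : FunLike (SigmaHom A B) A B where
  coe f := f.toFun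
  coe_injective f g h := by
    obtain ⟨⟨⟨⟨f, _⟩, _⟩, _, _⟩, _⟩ := f
    obtain ⟨⟨⟨⟨g, _⟩, _⟩, _, _⟩, _⟩ := g
    congr

instance : BoundedLatticeHomClass (SigmaHom A B) A B where
  map_sup f := f.map_sup'
  map_inf f := f.map_inf'
  map_top f := f.map_top'
  map_bot f := f.map_bot'

theorem SigmaHom.map_isLUB (f : SigmaHom A B) {p : ℕ → A} {s : A} (h : IsLUB (range p) s) :
    IsLUB (range fun n => f (p n)) (f s) := f.map_isLUB' p s h

theorem isLUB_mset_iff (U : ℕ → MSet Y) (S : MSet Y) :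
    IsLUB (range U) S ↔ (S : Set Y) = ⋃ n, (U n : Set Y) := by
  have key : IsLUB (range U) (⟨⋃ n, (U n : Set Y), .iUnion fun n => (U n).2⟩ : MSet Y) := by
    refine ⟨?_, fun V hV => ?_⟩
    · rintro _ ⟨n, rfl⟩
      exact subset_iUnion (fun n => (U n : Set Y)) n
    · exact iUnion_subset fun n => hV ⟨n, rfl⟩
  constructor
  · intro h
    exact congrArg Subtype.val (h.unique key)
  · intro h
    have : S = ⟨⋃ n, (U n : Set Y), .iUnion fun n => (U n).2⟩ := Subtype.ext h
    rwa [this]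

theorem SigmaHom.map_empty (f : SigmaHom (MSet Y) B) (h : MeasurableSet (∅ : Set Y)) :
    f ⟨∅, h⟩ = ⊥ := f.map_bot'

theorem SigmaHom.map_univ (f : SigmaHom (MSet Y) B) (h : MeasurableSet (univ : Set Y)) :
    f ⟨univ, h⟩ = ⊤ := f.map_top'

instance : IsBooleanSigmaAlgebra (MSet Y) where
  exists_isLUB U := ⟨⟨⋃ n, (U n : Set Y), .iUnion fun n => (U n).2⟩, (isLUB_mset_iff _ _).2 rfl⟩
  exists_isGLB U := by
    refine ⟨⟨⋂ n, (U n : Set Y), .iInter fun n => (U n).2⟩, ?_, fun V hV => ?_⟩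
    · rintro _ ⟨n, rfl⟩
      exact iInter_subset (fun n => (U n : Set Y)) n
    · exact subset_iInter fun n => hV ⟨n, rfl⟩

/-- The composition `g ∘ f`. -/
def SigmaHom.comp (g : SigmaHom B C) (f : SigmaHom A B) : SigmaHom A C where
  toFun a := g (f a)
  map_sup' a b := by simp
  map_inf' a b := by simp
  map_top' := by simp
  map_bot' := by simp
  map_isLUB' _ _ h := g.map_isLUB (f.map_isLUB h)

/-- Taking preimages along a measurable map `g : Y → Z` is a σ-homomorphism. -/
def SigmaHom.preimage (g : Y → Z) (hg : Measurable g) : SigmaHom (MSet Z) (MSet Y) where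
  toFun U := ⟨g ⁻¹' U, hg U.2⟩
  map_sup' _ _ := rfl
  map_inf' _ _ := rfl
  map_top' := rfl
  map_bot' := rfl
  map_isLUB' U S h := by
    rw [isLUB_mset_iff] at h ⊢
    simp [h]

@[simp] theorem SigmaHom.comp_preimage_apply (f : SigmaHom (MSet Y) B) (g : Y → Z)
    (hg : Measurable g) (U : MSet Z) :
    f.comp (SigmaHom.preimage g hg) U = f ⟨g ⁻¹' U, hg U.2⟩ := rfl

open Classical in
/-- The σ-homomorphism `U ↦ (p if y ∈ U) ∨ (¬ p if z ∈ U)`. -/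
def SigmaHom.twoPoint (p : B) (y z : Y) : SigmaHom (MSet Y) B where
  toFun U := (if y ∈ (U : Set Y) then p else ⊥) ⊔ (if z ∈ (U : Set Y) then pᶜ else ⊥)
  map_sup' U V := by
    by_cases h1 : y ∈ (U : Set Y) <;> by_cases h2 : z ∈ (U : Set Y) <;>
    by_cases h3 : y ∈ (V : Set Y) <;> by_cases h4 : z ∈ (V : Set Y) <;>
    simp [h1, h2, h3, h4]
  map_inf' U V := by
    by_cases h1 : y ∈ (U : Set Y) <;> by_cases h2 : z ∈ (U : Set Y) <;>
    by_cases h3 : y ∈ (V : Set Y) <;> by_cases h4 : z ∈ (V : Set Y) <;>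
    simp [h1, h2, h3, h4]
  map_top' := by simp
  map_bot' := by simp
  map_isLUB' U S h := by
    rw [isLUB_mset_iff] at h
    have hle : ∀ n, (U n : Set Y) ⊆ S := fun n => h ▸ subset_iUnion (fun n => (U n : Set Y)) n
    refine ⟨?_, fun b hb => ?_⟩
    · rintro _ ⟨n, rfl⟩
      refine sup_le_sup ?_ ?_
      · by_cases h1 : y ∈ (U n : Set Y)
        · simp [h1, hle n h1]
        · simp [h1]
      · by_cases h1 : z ∈ (U n : Set Y)
        · simp [h1, hle n h1]
        · simp [h1]
    · refine sup_le ?_ ?_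
      · split_ifs with h1
        · rw [h, mem_iUnion] at h1
          obtain ⟨n, hn⟩ := h1
          refine le_trans ?_ (hb ⟨n, rfl⟩)
          simp [hn]
        · exact bot_le
      · split_ifs with h1
        · rw [h, mem_iUnion] at h1
          obtain ⟨n, hn⟩ := h1
          refine le_trans ?_ (hb ⟨n, rfl⟩)
          simp [hn]
        · exact bot_le

open Classical in
/-- The σ-homomorphism `U ↦ (⊤ if y ∈ U, ⊥ otherwise)`. -/
def SigmaHom.dirac (y : Y) : SigmaHom (MSet Y) B where
  toFun U := if y ∈ (U : Set Y) then ⊤ else ⊥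
  map_sup' U V := by
    by_cases h1 : y ∈ (U : Set Y) <;> by_cases h3 : y ∈ (V : Set Y) <;> simp [h1, h3]
  map_inf' U V := by
    by_cases h1 : y ∈ (U : Set Y) <;> by_cases h3 : y ∈ (V : Set Y) <;> simp [h1, h3]
  map_top' := by simp
  map_bot' := by simp
  map_isLUB' U S h := by
    have := (SigmaHom.twoPoint (⊤ : B) y y).map_isLUB' U S h
    simp only [SigmaHom.twoPoint, compl_top, ite_self, sup_bot_eq] at this
    exact this

end SigmaHomBasics

/-! # Loomis–Sikorski representation

Auxiliary facts, used to construct the pairing of two σ-homomorphisms and to check the axioms of a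
C⋆-algebra. -/

section LoomisSikorski

/-- The Stone space of a Boolean algebra. -/
def StoneSp (B : Type u) [BooleanAlgebra B] : Type u :=
  {x : B → Bool // x ⊤ = true ∧ x ⊥ = false ∧ (∀ a b, x (a ⊓ b) = (x a && x b)) ∧
    (∀ a b, x (a ⊔ b) = (x a || x b))}

variable {B : Type u} [BooleanAlgebra B]

instance : TopologicalSpace (StoneSp B) := instTopologicalSpaceSubtype

instance : T2Space (StoneSp B) := inferInstanceAs (T2Space (Subtype _))

instance : CompactSpace (StoneSp B) := by
  refine isCompact_iff_compactSpace.1 (IsClosed.isCompact ?_)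
  refine (isClosed_eq (by fun_prop) (by fun_prop)).and
    ((isClosed_eq (by fun_prop) (by fun_prop)).and (IsClosed.and ?_ ?_))
  · simp only [ofPred_forall]
    refine isClosed_iInter fun a => isClosed_iInter fun b => isClosed_eq (by fun_prop) ?_
    exact (continuous_of_discreteTopology (f := fun p : Bool × Bool => (p.1 && p.2))).comp
      (f := fun x : B → Bool => (x a, x b)) (by fun_prop)
  · simp only [ofPred_forall]
    refine isClosed_iInter fun a => isClosed_iInter fun b => isClosed_eq (by fun_prop) ?_
    exact (continuous_of_discreteTopology (f := fun p : Bool × Bool => (p.1 || p.2))).comp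
      (f := fun x : B → Bool => (x a, x b)) (by fun_prop)

/-- The clopen set of an element of the Boolean algebra. -/
def clop (b : B) : Set (StoneSp B) := {x | x.1 b = true}

theorem clop_top : clop (⊤ : B) = univ := eq_univ_of_forall fun x => x.2.1
theorem clop_bot : clop (⊥ : B) = ∅ := eq_empty_of_forall_notMem fun x hx => by
  simp [clop, x.2.2.1] at hx
theorem clop_inf (a b : B) : clop (a ⊓ b) = clop a ∩ clop b := by
  ext x; simp [clop, x.2.2.2.1]
theorem clop_sup (a b : B) : clop (a ⊔ b) = clop a ∪ clop b := by
  ext x; simp [clop, x.2.2.2.2]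
theorem clop_compl (a : B) : clop aᶜ = (clop a)ᶜ := by
  refine (IsCompl.compl_eq ⟨?_, ?_⟩).symm
  · refine disjoint_iff.2 ((clop_inf a aᶜ).symm.trans ?_)
    rw [inf_compl_eq_bot, clop_bot]; rfl
  · refine codisjoint_iff.2 ((clop_sup a aᶜ).symm.trans ?_)
    rw [sup_compl_eq_top, clop_top]; rfl
theorem clop_mono {a b : B} (h : a ≤ b) : clop a ⊆ clop b := by
  rw [← inf_eq_left.2 h, clop_inf]; exact inter_subset_right

theorem isClopen_clop (b : B) : IsClopen (clop b) := by
  have hc : Continuous fun x : StoneSp B => x.1 b := (continuous_apply b).comp continuous_subtype_val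
  exact (isClopen_discrete {true}).preimage hc

theorem clop_nonempty {b : B} (hb : b ≠ ⊥) : (clop b).Nonempty := by
  obtain ⟨J, hJ, -, hd⟩ := DistribLattice.prime_ideal_of_disjoint_filter_ideal
    (F := Order.PFilter.principal b) (I := Order.Ideal.principal (⊥ : B)) (by
      rw [Set.disjoint_left]
      intro x hx hx'
      simp only [SetLike.mem_coe, Order.PFilter.mem_principal, Order.Ideal.mem_principal] at hx hx'
      exact hb (le_bot_iff.1 (hx.trans hx')))
  classical
  have hbJ : b ∉ J := fun h => Set.disjoint_left.1 hd (by simp) h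
  refine ⟨⟨fun c => decide (c ∉ J), ?_, ?_, ?_, ?_⟩, ?_⟩
  · simpa using fun h => hbJ (J.lower le_top h)
  · simp
  · intro x y
    have : x ⊓ y ∈ J ↔ x ∈ J ∨ y ∈ J :=
      ⟨fun h => hJ.mem_or_mem h, fun h => h.elim (J.lower inf_le_left) (J.lower inf_le_right)⟩
    simp only [this, not_or, Bool.decide_and]
  · intro x y
    have : x ⊔ y ∈ J ↔ x ∈ J ∧ y ∈ J := Order.Ideal.sup_mem_iff
    simp only [this, not_and_or, Bool.decide_or]
  · exact decide_eq_true hbJ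

/-- Every nonempty open set contains a nonempty clopen set of the form `clop b`. -/
theorem exists_clop_subset {O : Set (StoneSp B)} (hO : IsOpen O) {x : StoneSp B} (hx : x ∈ O) :
    ∃ b, x ∈ clop b ∧ clop b ⊆ O := by
  obtain ⟨O', hO', rfl⟩ := isOpen_induced_iff.1 hO
  obtain ⟨I, t, ht, hsub⟩ := isOpen_pi_iff.1 hO' x.1 hx
  have key : ∀ I : Finset B, ∃ b, x ∈ clop b ∧ ∀ y ∈ clop b, ∀ i ∈ I, y.1 i = x.1 i := by
    classical
    intro I
    induction I using Finset.induction_on with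
    | empty => exact ⟨⊤, by simp [clop_top], by simp⟩
    | insert i I _ ih =>
      obtain ⟨b, hb, hby⟩ := ih
      cases hxi : x.1 i with
      | true =>
        refine ⟨b ⊓ i, by rw [clop_inf]; exact ⟨hb, hxi⟩, fun y hy j hj => ?_⟩
        rw [clop_inf] at hy
        rcases Finset.mem_insert.1 hj with rfl | hj
        · rw [hxi]; exact hy.2
        · exact hby y hy.1 j hj
      | false =>
        refine ⟨b ⊓ iᶜ, by rw [clop_inf, clop_compl]; exact ⟨hb, by simp [clop, hxi]⟩,
          fun y hy j hj => ?_⟩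
        rw [clop_inf, clop_compl] at hy
        rcases Finset.mem_insert.1 hj with rfl | hj
        · rw [hxi]; simpa [clop] using hy.2
        · exact hby y hy.1 j hj
  obtain ⟨b, hb, hby⟩ := key I
  refine ⟨b, hb, fun y hy => hsub fun i hi => ?_⟩
  rw [hby y hy i hi]
  exact (ht i hi).2

theorem le_of_clop_eventuallyLE {a b : B} (h : clop a ≤ᶠ[residual _] clop b) : a ≤ b := by
  by_contra hab
  have hne : a ⊓ bᶜ ≠ ⊥ := fun h0 => hab <| by
    rwa [← disjoint_iff, disjoint_compl_right_iff] at h0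
  obtain ⟨x, hx, hx'⟩ := (dense_of_mem_residual h).inter_open_nonempty _
    (isClopen_clop (a ⊓ bᶜ)).isOpen (clop_nonempty hne)
  rw [clop_inf, clop_compl] at hx
  exact hx.2 (hx' hx.1)

theorem eq_of_clop_eventuallyEq {a b : B} (h : clop a =ᶠ[residual _] clop b) : a = b :=
  le_antisymm (le_of_clop_eventuallyLE h.le) (le_of_clop_eventuallyLE h.symm.le)

theorem clop_isLUB {p : ℕ → B} {s : B} (h : IsLUB (range p) s) :
    clop s =ᶠ[residual _] ⋃ n, clop (p n) := by
  refine Filter.EventuallyLE.antisymm ?_ (LE.le.eventuallyLE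
    (iUnion_subset fun n => clop_mono (h.1 ⟨n, rfl⟩)))
  have hopen : IsOpen ((clop s)ᶜ ∪ ⋃ n, clop (p n)) :=
    (isClopen_clop s).compl.isOpen.union (isOpen_iUnion fun n => (isClopen_clop (p n)).isOpen)
  have hdense : Dense ((clop s)ᶜ ∪ ⋃ n, clop (p n)) := by
    rw [dense_iff_inter_open]
    rintro O hO ⟨x, hx⟩
    obtain ⟨c, hxc, hc⟩ := exists_clop_subset hO hx
    by_contra hcon
    rw [not_nonempty_iff_eq_empty] at hcon
    have hcs : clop c ⊆ clop s := fun y hy => by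
      by_contra hys
      exact (hcon ▸ (⟨hc hy, Or.inl hys⟩ : y ∈ O ∩ _) : y ∈ (∅ : Set _))
    have hcp : ∀ n, p n ≤ s ⊓ cᶜ := fun n => le_inf (h.1 ⟨n, rfl⟩) (by
      refine le_of_clop_eventuallyLE (LE.le.eventuallyLE fun y hy => ?_)
      rw [clop_compl]
      intro hyc
      exact (hcon ▸ (⟨hc hyc, Or.inr (mem_iUnion.2 ⟨n, hy⟩)⟩ : y ∈ O ∩ _) : y ∈ (∅ : Set _)))
    have hs : s ≤ s ⊓ cᶜ := h.2 (by rintro _ ⟨n, rfl⟩; exact hcp n)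
    have := clop_mono hs (hcs hxc)
    rw [clop_inf, clop_compl] at this
    exact this.2 hxc
  filter_upwards [residual_of_dense_open hopen hdense] with x hx hxs
  exact hx.resolve_left fun h => h hxs

theorem clop_iUnion_of_isLUB {S : ℕ → Set (StoneSp B)} {p : ℕ → B} {s : B}
    (h : IsLUB (range p) s) (hS : ∀ n, S n =ᶠ[residual _] clop (p n)) :
    (⋃ n, S n) =ᶠ[residual _] clop s :=
  (Filter.EventuallyEq.countable_iUnion hS).trans (clop_isLUB h).symm

variable {Y Z : Type*} [MeasurableSpace Y] [MeasurableSpace Z]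

/-- The point map `F` on the Stone space represents the σ-homomorphism `f`. -/
def Reps (F : StoneSp B → Y) (f : SigmaHom (MSet Y) B) : Prop :=
  ∀ U : MSet Y, F ⁻¹' U =ᶠ[residual _] clop (f U)

theorem Reps.unique {F G : StoneSp B → Y} {f g : SigmaHom (MSet Y) B} (hF : Reps F f)
    (hG : Reps G g) (h : F =ᶠ[residual _] G) : f = g := by
  refine DFunLike.ext _ _ fun U => eq_of_clop_eventuallyEq ((hF U).symm.trans (.trans ?_ (hG U)))
  exact h.preimage U

theorem Reps.congr {F G : StoneSp B → Y} {f : SigmaHom (MSet Y) B} (hF : Reps F f)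
    (h : G =ᶠ[residual _] F) : Reps G f := fun U => (h.preimage U).trans (hF U)

theorem Reps.comp {F : StoneSp B → Y} {f : SigmaHom (MSet Y) B} (h : Reps F f) {g : Y → Z}
    (hg : Measurable g) : Reps (g ∘ F) (f.comp (SigmaHom.preimage g hg)) :=
  fun U => h ⟨g ⁻¹' U, hg U.2⟩

/-- To represent `f` it suffices to represent it on a generating family. -/
theorem Reps.of_generate {s : Set (Set Y)} (hs : ‹MeasurableSpace Y› = MeasurableSpace.generateFrom s)
    {F : StoneSp B → Y} {f : SigmaHom (MSet Y) B}
    (h : ∀ U : MSet Y, (U : Set Y) ∈ s → F ⁻¹' U =ᶠ[residual _] clop (f U)) : Reps F f := by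
  have key : ∀ U : Set Y, @MeasurableSet _ (MeasurableSpace.generateFrom s) U →
      ∀ hU : MeasurableSet U, F ⁻¹' U =ᶠ[residual _] clop (f ⟨U, hU⟩) := by
    intro U hU
    induction U, hU using MeasurableSpace.generateFrom_induction with
    | hC t ht _ => exact fun h' => h ⟨t, h'⟩ ht
    | empty =>
      intro h'
      rw [f.map_empty h', clop_bot, preimage_empty]
      rfl
    | compl t _ ih =>
      intro h'
      have : (⟨tᶜ, h'⟩ : MSet Y) = (⟨t, by simpa using h'.compl⟩ : MSet Y)ᶜ := rfl
      rw [this, map_compl', clop_compl, preimage_compl]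
      exact (ih _).compl
    | iUnion t ht ih =>
      intro h'
      have ht' : ∀ n, MeasurableSet (t n) := fun n => by rw [hs]; exact ht n
      rw [preimage_iUnion]
      exact clop_iUnion_of_isLUB (f.map_isLUB
        ((isLUB_mset_iff (fun n => ⟨t n, ht' n⟩) ⟨_, h'⟩).2 rfl)) fun n => ih n (ht' n)
  exact fun U => key U (by rw [← hs]; exact U.2) U.2

variable [IsBooleanSigmaAlgebra B]

/-- The σ-algebra of all sets that agree with a clopen set up to a meagre set. -/
instance : MeasurableSpace (StoneSp B) where
  MeasurableSet' S := ∃ b, S =ᶠ[residual _] clop b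
  measurableSet_empty := ⟨⊥, by rw [clop_bot]; rfl⟩
  measurableSet_compl := by
    rintro S ⟨b, hb⟩
    exact ⟨bᶜ, by rw [clop_compl]; exact hb.compl⟩
  measurableSet_iUnion := by
    intro S hS
    choose p hp using hS
    obtain ⟨s, hs⟩ := IsBooleanSigmaAlgebra.exists_isLUB p
    exact ⟨s, clop_iUnion_of_isLUB hs hp⟩

theorem measurableSet_stone {S : Set (StoneSp B)} :
    MeasurableSet S ↔ ∃ b, S =ᶠ[residual _] clop b := Iff.rfl

theorem measurableSet_of_ae {S T : Set (StoneSp B)} (h : S =ᶠ[residual _] T)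
    (hT : MeasurableSet T) : MeasurableSet S := by
  obtain ⟨b, hb⟩ := measurableSet_stone.1 hT
  exact ⟨b, h.trans hb⟩

/-- The element of the Boolean algebra represented by a measurable set of the Stone space. -/
def stoneClass (S : MSet (StoneSp B)) : B := (measurableSet_stone.1 S.2).choose

theorem stoneClass_spec (S : MSet (StoneSp B)) :
    (S : Set (StoneSp B)) =ᶠ[residual _] clop (stoneClass S) :=
  (measurableSet_stone.1 S.2).choose_spec

theorem stoneClass_eq {S : MSet (StoneSp B)} {b : B}
    (h : (S : Set (StoneSp B)) =ᶠ[residual _] clop b) : stoneClass S = b :=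
  eq_of_clop_eventuallyEq ((stoneClass_spec S).symm.trans h)

/-- The Loomis–Sikorski quotient map. -/
def stoneHom : SigmaHom (MSet (StoneSp B)) B where
  toFun := stoneClass
  map_sup' S T := stoneClass_eq (by
    rw [clop_sup]; exact (stoneClass_spec S).union (stoneClass_spec T))
  map_inf' S T := stoneClass_eq (by
    rw [clop_inf]; exact (stoneClass_spec S).inter (stoneClass_spec T))
  map_top' := stoneClass_eq (by rw [clop_top]; rfl)
  map_bot' := stoneClass_eq (by rw [clop_bot]; rfl)
  map_isLUB' S T h := by
    obtain ⟨s, hs⟩ := IsBooleanSigmaAlgebra.exists_isLUB fun n => stoneClass (S n)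
    have : stoneClass T = s := stoneClass_eq (by
      rw [(isLUB_mset_iff _ _).1 h]
      exact clop_iUnion_of_isLUB hs fun n => stoneClass_spec (S n))
    rw [this]; exact hs

theorem Reps.measurable {F : StoneSp B → Y} {f : SigmaHom (MSet Y) B} (h : Reps F f) :
    Measurable F := fun U hU => ⟨_, h ⟨U, hU⟩⟩

theorem exists_of_measurable {F : StoneSp B → Y} (hF : Measurable F) :
    ∃ f : SigmaHom (MSet Y) B, Reps F f :=
  ⟨stoneHom.comp (SigmaHom.preimage F hF), fun U => stoneClass_spec ⟨F ⁻¹' U, hF U.2⟩⟩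

theorem exists_reps [StandardBorelSpace Y] [Nonempty Y] (f : SigmaHom (MSet Y) B) :
    ∃ F : StoneSp B → Y, Reps F f := by
  set e : Y → ℕ → Bool := MeasurableSpace.mapNatBool Y with he
  have hem : Measurable e := MeasurableSpace.measurable_mapNatBool Y
  have hemb : MeasurableEmbedding e :=
    hem.measurableEmbedding (MeasurableSpace.injective_mapNatBool Y)
  let T : ℕ → Set (ℕ → Bool) := fun n => {t | t n = true}
  have hT : ∀ n, MeasurableSet (T n) := fun n =>
    measurableSet_eq_fun (measurable_pi_apply n) measurable_const
  let f' : SigmaHom (MSet (ℕ → Bool)) B := f.comp (SigmaHom.preimage e hem)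
  classical
  let G : StoneSp B → ℕ → Bool := fun x n => decide (x ∈ clop (f' ⟨T n, hT n⟩))
  have hgen : (inferInstance : MeasurableSpace (ℕ → Bool)) =
      MeasurableSpace.generateFrom (range T) := by
    refine le_antisymm ?_ (MeasurableSpace.generateFrom_le (by rintro _ ⟨n, rfl⟩; exact hT n))
    refine iSup_le fun n => ?_
    rw [← measurable_iff_comap_le]
    refine @measurable_to_bool _ (MeasurableSpace.generateFrom (range T)) _ ?_
    exact MeasurableSpace.measurableSet_generateFrom ⟨n, rfl⟩
  have hG : Reps G f' := Reps.of_generate hgen (by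
    rintro ⟨_, h⟩ ⟨n, rfl⟩
    refine EventuallyEq.of_eq ?_
    ext x
    simp [G, T])
  refine ⟨Function.invFun e ∘ G, fun U => ?_⟩
  have hr : ∀ᶠ x in residual (StoneSp B), G x ∈ range e := by
    have := hG ⟨range e, hemb.measurableSet_range⟩
    have h1 : f' ⟨range e, hemb.measurableSet_range⟩ = ⊤ := by
      have : (⟨e ⁻¹' range e, hem hemb.measurableSet_range⟩ : MSet Y) = ⟨univ, .univ⟩ :=
        Subtype.ext (preimage_range e)
      simp only [f', SigmaHom.comp_preimage_apply, this, f.map_univ]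
    rw [h1, clop_top] at this
    filter_upwards [this] with x hx
    exact (hx.mpr trivial : x ∈ G ⁻¹' range e)
  have hU := hG ⟨e '' U, hemb.measurableSet_image.2 U.2⟩
  have h2 : f' ⟨e '' U, hemb.measurableSet_image.2 U.2⟩ = f U := by
    have : (⟨e ⁻¹' (e '' U), hem (hemb.measurableSet_image.2 U.2)⟩ : MSet Y) = U :=
      Subtype.ext (preimage_image_eq _ hemb.injective)
    simp only [f', SigmaHom.comp_preimage_apply, this]
  rw [h2] at hU
  refine EventuallyEq.trans ?_ hU
  filter_upwards [hr] with x ⟨y, hy⟩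
  refine propext ?_
  change Function.invFun e (G x) ∈ (U : Set Y) ↔ G x ∈ e '' U
  rw [← hy, Function.leftInverse_invFun hemb.injective y]
  exact (hemb.injective.mem_set_image).symm

/-- The pairing of two σ-homomorphisms exists and is unique. -/
theorem existsUnique_pair (f g : SigmaHom (MSet ℂ) B) :
    ∃! T : SigmaHom (MSet (ℂ × ℂ)) B, ∀ U V : MSet ℂ, T ⟨U ×ˢ V, U.2.prod V.2⟩ = f U ⊓ g V := by
  obtain ⟨F, hF⟩ := exists_reps f
  obtain ⟨G, hG⟩ := exists_reps g
  obtain ⟨T, hT⟩ := exists_of_measurable (hF.measurable.prodMk hG.measurable)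
  refine ⟨T, fun U V => ?_, fun T' hT' => ?_⟩
  · refine eq_of_clop_eventuallyEq ((hT _).symm.trans ?_)
    rw [clop_inf]
    exact (hF U).inter (hG V)
  · refine Reps.unique (F := fun x => (F x, G x)) (Reps.of_generate generateFrom_prod.symm ?_)
      hT .rfl
    rintro ⟨_, h⟩ ⟨U, hU, V, hV, rfl⟩
    rw [hT' ⟨U, hU⟩ ⟨V, hV⟩, clop_inf]
    exact (hF ⟨U, hU⟩).inter (hG ⟨V, hV⟩)

end LoomisSikorski

/-! # The algebra of bounded abstract measurable functions -/

/-- The elements of `L^∞_abs(B)`: σ-homomorphisms `f` from the Borel sets of `ℂ` to `B` such that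
`f U = ⊤` for some bounded Borel set `U`. -/
@[ext] structure Linf (B : Type u) [BooleanAlgebra B] where
  hom : SigmaHom (MSet ℂ) B
  exists_bounded : ∃ U : MSet ℂ, Bornology.IsBounded (U : Set ℂ) ∧ hom U = ⊤

namespace Linf

section Operations

variable {B : Type u} [BooleanAlgebra B]

/-- The closed ball around `0`, as a Borel set. -/
def cball (r : ℝ) : MSet ℂ := ⟨Metric.closedBall 0 r, measurableSet_closedBall⟩

theorem exists_cball (f : Linf B) : ∃ r : ℝ, 0 ≤ r ∧ f.hom (cball r) = ⊤ := by
  obtain ⟨U, hU, hf⟩ := f.exists_bounded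
  obtain ⟨r, hr⟩ := hU.subset_closedBall 0
  refine ⟨max r 0, le_max_right _ _, top_unique ?_⟩
  rw [← hf]
  exact OrderHomClass.mono f.hom
    (hr.trans (Metric.closedBall_subset_closedBall (le_max_left _ _)) : (U : Set ℂ) ⊆ _)

/-- The characteristic function `χ_p`, the σ-homomorphism with `χ_p {1} = p`
and `χ_p {0} = ¬ p`. -/
def chi (p : B) : Linf B where
  hom := SigmaHom.twoPoint p 1 0
  exists_bounded := by
    refine ⟨cball 1, Metric.isBounded_closedBall, ?_⟩
    simp [SigmaHom.twoPoint, cball, DFunLike.coe]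

theorem chi_singleton_one (p : B) : (chi p).hom ⟨{1}, measurableSet_singleton 1⟩ = p := by
  simp [chi, SigmaHom.twoPoint, DFunLike.coe]

theorem chi_singleton_zero (p : B) : (chi p).hom ⟨{0}, measurableSet_singleton 0⟩ = pᶜ := by
  simp [chi, SigmaHom.twoPoint, DFunLike.coe]

/-- The constant function with value `c`. -/
def const (c : ℂ) : Linf B where
  hom := SigmaHom.dirac c
  exists_bounded := ⟨⟨{c}, measurableSet_singleton c⟩, Bornology.isBounded_singleton, by
    simp [SigmaHom.dirac, DFunLike.coe]⟩

/-- The composite of `f` with a continuous function `op : ℂ → ℂ`, given by `U ↦ f (op ⁻¹ U)`. -/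
def map₁ (op : ℂ → ℂ) (hop : Continuous op) (f : Linf B) : Linf B where
  hom := f.hom.comp (SigmaHom.preimage op hop.measurable)
  exists_bounded := by
    obtain ⟨r, -, hr⟩ := f.exists_cball
    have hc : IsCompact (op '' Metric.closedBall 0 r) :=
      (isCompact_closedBall 0 r).image hop
    refine ⟨⟨_, hc.measurableSet⟩, hc.isBounded, top_unique ?_⟩
    rw [← hr]
    refine OrderHomClass.mono f.hom ?_
    exact subset_preimage_image op (Metric.closedBall 0 r)

/-- The norm `‖f‖ = inf {r ≥ 0 | f (closed ball of radius r around 0) = ⊤}`. -/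
instance : Norm (Linf B) where
  norm f := sInf {r : ℝ | 0 ≤ r ∧ f.hom (cball r) = ⊤}

instance : Zero (Linf B) := ⟨const 0⟩
instance : One (Linf B) := ⟨const 1⟩
instance : Neg (Linf B) := ⟨map₁ (fun z => -z) continuous_neg⟩
/-- For `c ≠ 0` this is `(c • f) U = f (c⁻¹ U)`. -/
instance : SMul ℂ (Linf B) := ⟨fun c => map₁ (fun z => c * z) (continuous_const_mul c)⟩
instance : Star (Linf B) := ⟨map₁ (fun z => star z) continuous_star⟩

variable [IsBooleanSigmaAlgebra B]

/-- The pairing `⟨f, g⟩` of `f` and `g`: the unique σ-homomorphism from the Borel sets of `ℂ × ℂ`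
with `⟨f, g⟩ (U × V) = f U ∧ g V`. -/
def pair (f g : Linf B) : SigmaHom (MSet (ℂ × ℂ)) B := (existsUnique_pair f.hom g.hom).choose

theorem pair_prod (f g : Linf B) (U V : MSet ℂ) :
    pair f g ⟨U ×ˢ V, U.2.prod V.2⟩ = f.hom U ⊓ g.hom V :=
  (existsUnique_pair f.hom g.hom).choose_spec.1 U V

/-- The σ-homomorphism `U ↦ ⟨f, g⟩ (op ⁻¹ U)`, for a continuous function `op : ℂ × ℂ → ℂ`. -/
def map₂ (op : ℂ × ℂ → ℂ) (hop : Continuous op) (f g : Linf B) : Linf B where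
  hom := (pair f g).comp (SigmaHom.preimage op hop.measurable)
  exists_bounded := by
    obtain ⟨r, -, hr⟩ := f.exists_cball
    obtain ⟨s, -, hs⟩ := g.exists_cball
    have hc : IsCompact (op '' (Metric.closedBall 0 r ×ˢ Metric.closedBall 0 s)) :=
      ((isCompact_closedBall 0 r).prod (isCompact_closedBall 0 s)).image hop
    refine ⟨⟨_, hc.measurableSet⟩, hc.isBounded, top_unique ?_⟩
    have h := pair_prod f g (cball r) (cball s)
    rw [hr, hs, top_inf_eq] at h
    rw [← h]
    refine OrderHomClass.mono (pair f g) ?_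
    exact subset_preimage_image op (Metric.closedBall 0 r ×ˢ Metric.closedBall 0 s)

instance : Add (Linf B) := ⟨map₂ (fun z => z.1 + z.2) continuous_add⟩
instance : Mul (Linf B) := ⟨map₂ (fun z => z.1 * z.2) continuous_mul⟩

end Operations

/-! Verification of the axioms of a commutative C⋆-algebra. -/

section Axioms

variable {B : Type u} [BooleanAlgebra B]

theorem reps_const (c : ℂ) : Reps (fun _ => c) (const c : Linf B).hom := by
  intro U
  refine EventuallyEq.of_eq ?_
  by_cases h : c ∈ (U : Set ℂ)
  · have : (const c : Linf B).hom U = ⊤ := by simp [const, SigmaHom.dirac, DFunLike.coe, h]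
    rw [this, clop_top]
    exact eq_univ_of_forall fun _ => h
  · have : (const c : Linf B).hom U = ⊥ := by simp [const, SigmaHom.dirac, DFunLike.coe, h]
    rw [this, clop_bot]
    exact eq_empty_of_forall_notMem fun _ => h

theorem reps_map₁ {op : ℂ → ℂ} (hop : Continuous op) {F : StoneSp B → ℂ} {f : Linf B}
    (hF : Reps F f.hom) : Reps (fun x => op (F x)) (map₁ op hop f).hom :=
  hF.comp hop.measurable

theorem hom_eq_top_iff {F : StoneSp B → ℂ} {f : Linf B} (hF : Reps F f.hom) (U : MSet ℂ) :
    f.hom U = ⊤ ↔ ∀ᶠ x in residual (StoneSp B), F x ∈ (U : Set ℂ) := by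
  constructor
  · intro h
    have := hF U
    rw [h, clop_top] at this
    filter_upwards [this] with x hx
    exact (hx.mpr trivial : x ∈ F ⁻¹' U)
  · intro h
    refine eq_of_clop_eventuallyEq ((hF U).symm.trans ?_)
    rw [clop_top]
    filter_upwards [h] with x hx
    exact eq_true hx

theorem eq_of_reps {F G : StoneSp B → ℂ} {f g : Linf B} (hF : Reps F f.hom) (hG : Reps G g.hom)
    (h : ∀ x, F x = G x) : f = g :=
  Linf.ext (hF.unique hG (Eventually.of_forall h))

theorem reps_zero : Reps (fun _ => 0) (0 : Linf B).hom := reps_const 0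
theorem reps_one : Reps (fun _ => 1) (1 : Linf B).hom := reps_const 1

theorem reps_neg {F : StoneSp B → ℂ} {f : Linf B} (hF : Reps F f.hom) :
    Reps (fun x => -F x) (-f).hom := reps_map₁ continuous_neg hF

theorem reps_smul {F : StoneSp B → ℂ} {f : Linf B} (hF : Reps F f.hom) (c : ℂ) :
    Reps (fun x => c * F x) (c • f).hom := reps_map₁ (continuous_const_mul c) hF

theorem reps_star {F : StoneSp B → ℂ} {f : Linf B} (hF : Reps F f.hom) :
    Reps (fun x => star (F x)) (star f).hom := reps_map₁ continuous_star hF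

theorem bddBelow_norm (f : Linf B) : BddBelow {r : ℝ | 0 ≤ r ∧ f.hom (cball r) = ⊤} :=
  ⟨0, fun _ h => h.1⟩

theorem norm_nonneg' (f : Linf B) : 0 ≤ ‖f‖ := Real.sInf_nonneg fun _ h => h.1

theorem norm_le_iff {F : StoneSp B → ℂ} {f : Linf B} (hF : Reps F f.hom) {r : ℝ} (hr : 0 ≤ r) :
    ‖f‖ ≤ r ↔ ∀ᶠ x in residual (StoneSp B), ‖F x‖ ≤ r := by
  have key : ∀ s : ℝ, f.hom (cball s) = ⊤ ↔ ∀ᶠ x in residual (StoneSp B), ‖F x‖ ≤ s := fun s => by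
    rw [hom_eq_top_iff hF]; simp [cball]
  constructor
  · intro h
    have : ∀ n : ℕ, ∀ᶠ x in residual (StoneSp B), ‖F x‖ ≤ r + 1 / ((n : ℝ) + 1) := fun n => by
      obtain ⟨s, hs, hlt⟩ := exists_lt_of_csInf_lt
        (s := {r : ℝ | 0 ≤ r ∧ f.hom (cball r) = ⊤}) f.exists_cball
        (lt_of_le_of_lt h (lt_add_of_pos_right r (by positivity : (0 : ℝ) < 1 / ((n : ℝ) + 1))))
      filter_upwards [(key s).1 hs.2] with x hx using hx.trans hlt.le
    filter_upwards [eventually_countable_forall.2 this] with x hx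
    refine ge_of_tendsto' (x := atTop) (f := fun n : ℕ => r + 1 / ((n : ℝ) + 1)) ?_ hx
    simpa using tendsto_const_nhds.add (tendsto_one_div_add_atTop_nhds_zero_nat (𝕜 := ℝ))
  · intro h
    exact csInf_le (bddBelow_norm f) ⟨hr, (key r).2 h⟩

theorem ae_norm_le {F : StoneSp B → ℂ} {f : Linf B} (hF : Reps F f.hom) :
    ∀ᶠ x in residual (StoneSp B), ‖F x‖ ≤ ‖f‖ := (norm_le_iff hF (norm_nonneg' f)).1 le_rfl

variable [IsBooleanSigmaAlgebra B]

theorem reps_pair {F G : StoneSp B → ℂ} {f g : Linf B} (hF : Reps F f.hom) (hG : Reps G g.hom) :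
    Reps (fun x => (F x, G x)) (pair f g) := by
  refine Reps.of_generate generateFrom_prod.symm ?_
  rintro ⟨_, h⟩ ⟨U, hU, V, hV, rfl⟩
  rw [pair_prod f g ⟨U, hU⟩ ⟨V, hV⟩, clop_inf]
  exact (hF ⟨U, hU⟩).inter (hG ⟨V, hV⟩)

theorem reps_map₂ {op : ℂ × ℂ → ℂ} (hop : Continuous op) {F G : StoneSp B → ℂ} {f g : Linf B}
    (hF : Reps F f.hom) (hG : Reps G g.hom) :
    Reps (fun x => op (F x, G x)) (map₂ op hop f g).hom :=
  (reps_pair hF hG).comp hop.measurable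

theorem exists_rep (f : Linf B) : ∃ F : StoneSp B → ℂ, Reps F f.hom := exists_reps f.hom

theorem reps_add {F G : StoneSp B → ℂ} {f g : Linf B} (hF : Reps F f.hom)
    (hG : Reps G g.hom) :
    Reps (fun x => F x + G x) (f + g).hom := reps_map₂ continuous_add hF hG

theorem reps_mul {F G : StoneSp B → ℂ} {f g : Linf B} (hF : Reps F f.hom)
    (hG : Reps G g.hom) :
    Reps (fun x => F x * G x) (f * g).hom := reps_map₂ continuous_mul hF hG

instance : CommRing (Linf B) where
  add_assoc f g h := by
    obtain ⟨F, hF⟩ := f.exists_rep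
    obtain ⟨G, hG⟩ := g.exists_rep
    obtain ⟨H, hH⟩ := h.exists_rep
    exact eq_of_reps (reps_add (reps_add hF hG) hH) (reps_add hF (reps_add hG hH))
      fun x => add_assoc _ _ _
  zero_add f := by
    obtain ⟨F, hF⟩ := f.exists_rep
    exact eq_of_reps (reps_add reps_zero hF) hF fun x => zero_add _
  add_zero f := by
    obtain ⟨F, hF⟩ := f.exists_rep
    exact eq_of_reps (reps_add hF reps_zero) hF fun x => add_zero _
  add_comm f g := by
    obtain ⟨F, hF⟩ := f.exists_rep
    obtain ⟨G, hG⟩ := g.exists_rep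
    exact eq_of_reps (reps_add hF hG) (reps_add hG hF) fun x => add_comm _ _
  left_distrib f g h := by
    obtain ⟨F, hF⟩ := f.exists_rep
    obtain ⟨G, hG⟩ := g.exists_rep
    obtain ⟨H, hH⟩ := h.exists_rep
    exact eq_of_reps (reps_mul hF (reps_add hG hH)) (reps_add (reps_mul hF hG) (reps_mul hF hH))
      fun x => mul_add _ _ _
  right_distrib f g h := by
    obtain ⟨F, hF⟩ := f.exists_rep
    obtain ⟨G, hG⟩ := g.exists_rep
    obtain ⟨H, hH⟩ := h.exists_rep
    exact eq_of_reps (reps_mul (reps_add hF hG) hH) (reps_add (reps_mul hF hH) (reps_mul hG hH))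
      fun x => add_mul _ _ _
  zero_mul f := by
    obtain ⟨F, hF⟩ := f.exists_rep
    exact eq_of_reps (reps_mul reps_zero hF) reps_zero fun x => zero_mul _
  mul_zero f := by
    obtain ⟨F, hF⟩ := f.exists_rep
    exact eq_of_reps (reps_mul hF reps_zero) reps_zero fun x => mul_zero _
  mul_assoc f g h := by
    obtain ⟨F, hF⟩ := f.exists_rep
    obtain ⟨G, hG⟩ := g.exists_rep
    obtain ⟨H, hH⟩ := h.exists_rep
    exact eq_of_reps (reps_mul (reps_mul hF hG) hH) (reps_mul hF (reps_mul hG hH))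
      fun x => mul_assoc _ _ _
  one_mul f := by
    obtain ⟨F, hF⟩ := f.exists_rep
    exact eq_of_reps (reps_mul reps_one hF) hF fun x => one_mul _
  mul_one f := by
    obtain ⟨F, hF⟩ := f.exists_rep
    exact eq_of_reps (reps_mul hF reps_one) hF fun x => mul_one _
  mul_comm f g := by
    obtain ⟨F, hF⟩ := f.exists_rep
    obtain ⟨G, hG⟩ := g.exists_rep
    exact eq_of_reps (reps_mul hF hG) (reps_mul hG hF) fun x => mul_comm _ _
  neg_add_cancel f := by
    obtain ⟨F, hF⟩ := f.exists_rep
    exact eq_of_reps (reps_add (reps_neg hF) hF) reps_zero fun x => neg_add_cancel _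
  nsmul := nsmulRec
  zsmul := zsmulRec

instance : Module ℂ (Linf B) where
  one_smul f := by
    obtain ⟨F, hF⟩ := f.exists_rep
    exact eq_of_reps (reps_smul hF 1) hF fun x => one_mul _
  mul_smul a b f := by
    obtain ⟨F, hF⟩ := f.exists_rep
    exact eq_of_reps (reps_smul hF (a * b)) (reps_smul (reps_smul hF b) a) fun x => mul_assoc _ _ _
  smul_zero a := eq_of_reps (reps_smul reps_zero a) reps_zero fun x => mul_zero _
  smul_add a f g := by
    obtain ⟨F, hF⟩ := f.exists_rep
    obtain ⟨G, hG⟩ := g.exists_rep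
    exact eq_of_reps (reps_smul (reps_add hF hG) a) (reps_add (reps_smul hF a) (reps_smul hG a))
      fun x => mul_add _ _ _
  add_smul a b f := by
    obtain ⟨F, hF⟩ := f.exists_rep
    exact eq_of_reps (reps_smul hF (a + b)) (reps_add (reps_smul hF a) (reps_smul hF b))
      fun x => add_mul _ _ _
  zero_smul f := by
    obtain ⟨F, hF⟩ := f.exists_rep
    exact eq_of_reps (reps_smul hF 0) reps_zero fun x => zero_mul _

instance : Algebra ℂ (Linf B) :=
  Algebra.ofModule
    (fun a f g => by
      obtain ⟨F, hF⟩ := f.exists_rep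
      obtain ⟨G, hG⟩ := g.exists_rep
      exact eq_of_reps (reps_mul (reps_smul hF a) hG) (reps_smul (reps_mul hF hG) a)
        fun x => mul_assoc _ _ _)
    (fun a f g => by
      obtain ⟨F, hF⟩ := f.exists_rep
      obtain ⟨G, hG⟩ := g.exists_rep
      exact eq_of_reps (reps_mul hF (reps_smul hG a)) (reps_smul (reps_mul hF hG) a)
        fun x => mul_left_comm _ _ _)

instance : StarRing (Linf B) where
  star_involutive f := by
    obtain ⟨F, hF⟩ := f.exists_rep
    exact eq_of_reps (reps_star (reps_star hF)) hF fun x => star_star _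
  star_mul f g := by
    obtain ⟨F, hF⟩ := f.exists_rep
    obtain ⟨G, hG⟩ := g.exists_rep
    exact eq_of_reps (reps_star (reps_mul hF hG)) (reps_mul (reps_star hG) (reps_star hF))
      fun x => star_mul _ _
  star_add f g := by
    obtain ⟨F, hF⟩ := f.exists_rep
    obtain ⟨G, hG⟩ := g.exists_rep
    exact eq_of_reps (reps_star (reps_add hF hG)) (reps_add (reps_star hF) (reps_star hG))
      fun x => star_add _ _

instance : StarModule ℂ (Linf B) where
  star_smul a f := by
    obtain ⟨F, hF⟩ := f.exists_rep
    exact eq_of_reps (reps_star (reps_smul hF a)) (reps_smul (reps_star hF) (star a))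
      fun x => star_mul' _ _

theorem norm_smul_le' (c : ℂ) (f : Linf B) : ‖c • f‖ ≤ ‖c‖ * ‖f‖ := by
  obtain ⟨F, hF⟩ := f.exists_rep
  refine (norm_le_iff (reps_smul hF c) (mul_nonneg (norm_nonneg c) (norm_nonneg' f))).2 ?_
  filter_upwards [ae_norm_le hF] with x hx
  rw [norm_mul]
  gcongr

theorem normCore : NormedSpace.Core ℂ (Linf B) where
  norm_nonneg := norm_nonneg'
  norm_smul c f := by
    refine le_antisymm (norm_smul_le' c f) ?_
    by_cases hc : c = 0
    · simpa [hc] using norm_nonneg' ((0 : ℂ) • f)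
    · have h := norm_smul_le' c⁻¹ (c • f)
      rw [smul_smul, inv_mul_cancel₀ hc, one_smul, norm_inv] at h
      have hc' : 0 < ‖c‖ := norm_pos_iff.2 hc
      calc ‖c‖ * ‖f‖ ≤ ‖c‖ * (‖c‖⁻¹ * ‖c • f‖) := by gcongr
        _ = ‖c • f‖ := by field_simp
  norm_triangle f g := by
    obtain ⟨F, hF⟩ := f.exists_rep
    obtain ⟨G, hG⟩ := g.exists_rep
    refine (norm_le_iff (reps_add hF hG) (add_nonneg (norm_nonneg' f) (norm_nonneg' g))).2 ?_
    filter_upwards [ae_norm_le hF, ae_norm_le hG] with x hx hy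
    exact (norm_add_le _ _).trans (add_le_add hx hy)
  norm_eq_zero_iff f := by
    obtain ⟨F, hF⟩ := f.exists_rep
    constructor
    · intro h
      refine Linf.ext (hF.unique reps_zero ?_)
      filter_upwards [ae_norm_le hF] with x hx
      rw [h] at hx
      exact norm_le_zero_iff.1 hx
    · rintro rfl
      refine le_antisymm ((norm_le_iff reps_zero le_rfl).2 ?_) (norm_nonneg' _)
      simp

instance : NormedCommRing (Linf B) :=
  { NormedAddCommGroup.ofCore normCore, (inferInstance : CommRing (Linf B)) with
    norm_mul_le := fun f g => by
      obtain ⟨F, hF⟩ := f.exists_rep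
      obtain ⟨G, hG⟩ := g.exists_rep
      refine (norm_le_iff (reps_mul hF hG) (mul_nonneg (norm_nonneg' f) (norm_nonneg' g))).2 ?_
      filter_upwards [ae_norm_le hF, ae_norm_le hG] with x hx hy
      rw [norm_mul]
      exact mul_le_mul hx hy (norm_nonneg _) (norm_nonneg' f) }

instance : NormedAlgebra ℂ (Linf B) where
  norm_smul_le := norm_smul_le'

instance : CStarRing (Linf B) where
  norm_mul_self_le f := by
    obtain ⟨F, hF⟩ := f.exists_rep
    have h := ae_norm_le (reps_mul (reps_star hF) hF)
    have h2 : ‖f‖ ≤ Real.sqrt ‖star f * f‖ := by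
      refine (norm_le_iff hF (Real.sqrt_nonneg _)).2 ?_
      filter_upwards [h] with x hx
      refine Real.le_sqrt_of_sq_le ?_
      rwa [norm_mul, norm_star, ← sq] at hx
    calc ‖f‖ * ‖f‖ ≤ Real.sqrt ‖star f * f‖ * Real.sqrt ‖star f * f‖ := by gcongr
      _ = ‖star f * f‖ := Real.mul_self_sqrt (norm_nonneg' _)

theorem reps_sub {F G : StoneSp B → ℂ} {f g : Linf B} (hF : Reps F f.hom) (hG : Reps G g.hom) :
    Reps (fun x => F x - G x) (f - g).hom := by
  rw [sub_eq_add_neg]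
  simpa only [sub_eq_add_neg] using reps_add hF (reps_neg hG)

instance : CompleteSpace (Linf B) := by
  refine Metric.complete_of_cauchySeq_tendsto fun u hu => ?_
  choose F hF using fun n => (u n).exists_rep
  have hae : ∀ᶠ x in residual (StoneSp B), ∀ n m, ‖F n x - F m x‖ ≤ ‖u n - u m‖ :=
    eventually_countable_forall.2 fun n => eventually_countable_forall.2 fun m =>
      ae_norm_le (reps_sub (hF n) (hF m))
  set S : Set (StoneSp B) := {x | ∀ n m, ‖F n x - F m x‖ ≤ ‖u n - u m‖} with hS
  classical
  let F' : ℕ → StoneSp B → ℂ := fun n x => if x ∈ S then F n x else 0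
  have hF'F : ∀ n, F' n =ᶠ[residual _] F n := fun n => by
    filter_upwards [hae] with x hx
    exact if_pos hx
  have hF' : ∀ n, Reps (F' n) (u n).hom := fun n => (hF n).congr (hF'F n)
  have hdiff : ∀ x n m, ‖F' n x - F' m x‖ ≤ ‖u n - u m‖ := by
    intro x n m
    by_cases hx : x ∈ S
    · simpa only [F', if_pos hx] using hx n m
    · simp [F', hx]
  have hcau : ∀ x, CauchySeq fun n => F' n x := by
    intro x
    rw [Metric.cauchySeq_iff] at hu ⊢
    intro ε hε
    obtain ⟨N, hN⟩ := hu ε hε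
    refine ⟨N, fun m hm n hn => ?_⟩
    have := hN m hm n hn
    rw [dist_eq_norm] at this ⊢
    exact (hdiff x m n).trans_lt this
  choose G hG using fun x => cauchySeq_tendsto_of_complete (hcau x)
  have hGm : Measurable G :=
    measurable_of_tendsto_metrizable (fun n => (hF' n).measurable) (tendsto_pi_nhds.2 hG)
  obtain ⟨g, hg⟩ := exists_of_measurable hGm
  have hbound : ∀ ε > 0, ∃ N, ∀ n ≥ N, ∀ x, ‖F' n x - G x‖ ≤ ε := by
    intro ε hε
    obtain ⟨N, hN⟩ := Metric.cauchySeq_iff.1 hu ε hε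
    refine ⟨N, fun n hn x => ?_⟩
    refine le_of_tendsto ((tendsto_const_nhds.sub (hG x)).norm) ?_
    filter_upwards [eventually_ge_atTop N] with m hm
    have := hN n hn m hm
    rw [dist_eq_norm] at this
    exact (hdiff x n m).trans this.le
  obtain ⟨N, hN⟩ := hbound 1 one_pos
  have hgb : ∀ᶠ x in residual (StoneSp B), ‖G x‖ ≤ ‖u N‖ + 1 := by
    filter_upwards [ae_norm_le (hF' N)] with x hx
    calc ‖G x‖ = ‖F' N x - (F' N x - G x)‖ := by rw [sub_sub_cancel]
      _ ≤ ‖F' N x‖ + ‖F' N x - G x‖ := norm_sub_le _ _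
      _ ≤ _ := add_le_add hx (hN N le_rfl x)
  refine ⟨⟨g, cball (‖u N‖ + 1), Metric.isBounded_closedBall, ?_⟩, ?_⟩
  · refine eq_of_clop_eventuallyEq ((hg _).symm.trans ?_)
    rw [clop_top]
    filter_upwards [hgb] with x hx
    refine eq_true ?_
    change G x ∈ Metric.closedBall 0 _
    simpa using hx
  · rw [Metric.tendsto_atTop]
    intro ε hε
    obtain ⟨N, hN⟩ := hbound (ε / 2) (half_pos hε)
    refine ⟨N, fun n hn => lt_of_le_of_lt ?_ (half_lt_self hε)⟩
    rw [dist_eq_norm]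
    exact (norm_le_iff (reps_sub (hF' n) hg) (half_pos hε).le).2
      (Eventually.of_forall fun x => hN n hn x)

instance : CommCStarAlgebra (Linf B) where

/-- The usual order of a C⋆-algebra: `f ≤ g` iff `g - f` is positive. -/
instance : PartialOrder (Linf B) := CStarAlgebra.spectralOrder (Linf B)

instance : StarOrderedRing (Linf B) := CStarAlgebra.spectralOrderedRing (Linf B)

end Axioms

end Linf

/-! # σC⋆-algebras, σ-normal maps, POVMs and PVMs -/

/-- A σC⋆-algebra: every norm-bounded increasing sequence of self-adjoint elements has a supremum
in the poset of self-adjoint elements. -/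
class IsSigmaCStarAlgebra (A : Type u) [CStarAlgebra A] [PartialOrder A] [StarOrderedRing A] :
    Prop where
  exists_isLUB : ∀ a : ℕ → selfAdjoint A, Monotone a → (∃ C : ℝ, ∀ n, ‖(a n : A)‖ ≤ C) →
    ∃ s, IsLUB (range a) s

section Definitions

variable {B : Type u} [BooleanAlgebra B] {A : Type v} {A' : Type w}
  [CStarAlgebra A] [PartialOrder A] [StarOrderedRing A]
  [CStarAlgebra A'] [PartialOrder A'] [StarOrderedRing A']

/-- `a n ↗ s`: the sequence of self-adjoint elements is norm-bounded and increasing, with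
supremum `s` among the self-adjoint elements. -/
def IncreasesTo (a : ℕ → selfAdjoint A) (s : selfAdjoint A) : Prop :=
  Monotone a ∧ (∃ C : ℝ, ∀ n, ‖(a n : A)‖ ≤ C) ∧ IsLUB (range a) s

/-- A map is σ-normal if `a n ↗ s` implies that `φ s` is the supremum of the `φ (a n)`. For
positive linear `φ` and self-adjoint `a n` it makes no difference whether this supremum is taken in
the codomain or among its self-adjoint elements, since anything above a self-adjoint element is
self-adjoint. -/
def IsSigmaNormal (φ : A → A') : Prop :=
  ∀ (a : ℕ → selfAdjoint A) (s : selfAdjoint A), IncreasesTo a s →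
    IsLUB (range fun n => φ (a n)) (φ s)

/-- The infinite sum of a sequence of positive elements is `s`: the supremum of the finite partial
sums exists and equals `s`. -/
def HasOrderSum (a : ℕ → A) (s : A) : Prop :=
  IsLUB (range fun F : Finset ℕ => ∑ i ∈ F, a i) s

/-- Positive operator valued measures on `B` with values in `A`. -/
structure IsPOVM (μ : B → A) : Prop where
  nonneg : ∀ p, 0 ≤ μ p
  map_top : μ ⊤ = 1
  sigma_additive : ∀ (p : ℕ → B) (s : B), (∀ m n, m ≠ n → p m ⊓ p n = ⊥) →
    IsLUB (range p) s → HasOrderSum (fun n => μ (p n)) (μ s)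

/-- Projection valued measures. -/
structure IsPVM (μ : B → A) : Prop extends IsPOVM μ where
  map_inf : ∀ p q, μ (p ⊓ q) = μ p * μ q

/-- `φ` is a σ-cpu map: completely positive (by its type), unital and σ-normal. -/
def IsSigmaCPU (φ : A →CP A') : Prop := φ 1 = 1 ∧ IsSigmaNormal φ

end Definitions

end PovmIntegration

end

open PovmIntegration

open Set Filter Topology
open scoped CStarAlgebra

noncomputable section

namespace PovmIntegration

open MeasureTheory

/-! ### Characteristic functions and the order of `Linf B`, seen on the Stone space -/

namespace Linf

variable {B : Type*} [BooleanAlgebra B]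

/-! By Loomis–Sikorski, an element of `Linf B` is a function on the Stone space of `B`, bounded and
measurable modulo meagre sets (`Reps`), with `chi p` the indicator of `clop p`. Algebra, norm and
order become pointwise off a meagre set (`nonneg_iff`, `le_iff`), so the theorem is integration
theory with "almost everywhere" read as "off a meagre set".

Existence. A POVM gives a finitely additive `A`-valued measure on the Stone space, hence an integral
of simple functions. Positivity bounds it by a constant times the essential norm
(`norm_simpleIntegral_le`). Simple functions are norm dense, so it extends to a continuous linear
map `integral`.

Complete positivity. A positive matrix is `star N * N`, with `N` approximated entrywise by a matrix
of simple functions. For such a matrix the integral is a finite sum of terms `star (R v) * R v`,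
where `R v` is the scalar matrix `v` times the square root of the measure of its fibre
(`map_integral_star_mul_self_nonneg`).

σ-normality. Sums of the POVM converge only in order, so an Egorov argument replaces norm
convergence. If `a n` increases to `s`, then `s` is at most `a n + ε` up to a bounded multiple of `1
- chi (d n)`, with `d n` increasing to `⊤` (`exists_le_add_chi_compl`). Continuity from below of the
POVM then removes the error.

Uniqueness. Positive linear maps between C⋆-algebras are continuous, and the `chi p` span a dense
subspace. The same density makes the integral of a PVM multiplicative. Conversely, `chi` turns
increasing suprema in `B` into increasing suprema in `Linf B`, so σ-normal maps restrict to POVMs,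
and multiplicative ones to PVMs. -/

theorem reps_chi (p : B) :
    Reps ((clop p).indicator fun _ => (1 : ℂ)) (chi p).hom := by
  classical
  intro U
  refine EventuallyEq.of_eq ?_
  ext x
  change (clop p).indicator (fun _ => (1 : ℂ)) x ∈ (U : Set ℂ) ↔ x ∈ clop
    ((if (1 : ℂ) ∈ (U : Set ℂ) then p else ⊥) ⊔ (if (0 : ℂ) ∈ (U : Set ℂ) then pᶜ else ⊥))
  rw [clop_sup]
  by_cases hx : x ∈ clop p <;> by_cases h1 : (1 : ℂ) ∈ (U : Set ℂ) <;>
    by_cases h0 : (0 : ℂ) ∈ (U : Set ℂ) <;> simp [hx, h0, h1, clop_compl, clop_bot]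

theorem eq_of_reps_ae {F G : StoneSp B → ℂ} {f g : Linf B} (hF : Reps F f.hom)
    (hG : Reps G g.hom) (h : F =ᶠ[residual _] G) : f = g :=
  Linf.ext (hF.unique hG h)

theorem chi_top : chi (⊤ : B) = 1 :=
  eq_of_reps (reps_chi _) reps_one fun x => by simp [clop_top]

theorem chi_bot : chi (⊥ : B) = 0 :=
  eq_of_reps (reps_chi _) reps_zero fun x => by simp [clop_bot]

theorem star_chi (p : B) : star (chi p) = chi p :=
  eq_of_reps (reps_star (reps_chi p)) (reps_chi p) fun x => by
    by_cases hp : x ∈ clop p <;> simp [hp]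

theorem norm_chi_le (p : B) : ‖chi p‖ ≤ 1 := by
  refine (norm_le_iff (reps_chi p) zero_le_one).2 (Eventually.of_forall fun x => ?_)
  by_cases hp : x ∈ clop p <;> simp [hp]

variable [IsBooleanSigmaAlgebra B]

/-- Two point maps representing the same element agree off a meagre set. -/
theorem ae_eq_of_reps {F G : StoneSp B → ℂ} {f : Linf B} (hF : Reps F f.hom)
    (hG : Reps G f.hom) : F =ᶠ[residual _] G := by
  have h := ae_norm_le (reps_sub hF hG)
  filter_upwards [h] with x hx
  rw [sub_self, norm_zero] at hx
  exact sub_eq_zero.1 (norm_le_zero_iff.1 hx)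

/-- An essentially bounded measurable function on the Stone space defines an element
of `Linf B`. -/
theorem exists_reps_of_bounded {F : StoneSp B → ℂ} (hF : Measurable F) {C : ℝ}
    (hC : ∀ᶠ x in residual (StoneSp B), ‖F x‖ ≤ C) : ∃ f : Linf B, Reps F f.hom := by
  obtain ⟨g, hg⟩ := exists_of_measurable hF
  refine ⟨⟨g, cball C, Metric.isBounded_closedBall, eq_of_clop_eventuallyEq ((hg _).symm.trans ?_)⟩,
    hg⟩
  rw [clop_top]
  filter_upwards [hC] with x hx
  refine eq_true ?_
  change F x ∈ Metric.closedBall 0 _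
  simpa using hx

/-- Every element is represented by a function bounded by its norm. -/
theorem exists_rep_norm_le (f : Linf B) :
    ∃ F : StoneSp B → ℂ, Reps F f.hom ∧ ∀ x, ‖F x‖ ≤ ‖f‖ := by
  obtain ⟨F, hF⟩ := f.exists_rep
  refine ⟨{x | ‖F x‖ ≤ ‖f‖}.indicator F, hF.congr ?_, fun x => ?_⟩
  · filter_upwards [ae_norm_le hF] with x hx
    exact indicator_of_mem (s := {x | ‖F x‖ ≤ ‖f‖}) hx F
  · by_cases hx : x ∈ {x | ‖F x‖ ≤ ‖f‖}
    · rw [indicator_of_mem hx]; exact hx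
    · rw [indicator_of_notMem hx, norm_zero]; exact norm_nonneg f

open ComplexOrder in
-- Positive elements are the `star g * g`, and these have pointwise nonnegative representatives.
-- Conversely, the square root of the real part of `F` is measurable and essentially bounded, so it
-- represents a self-adjoint square root of `f`.
theorem nonneg_iff {F : StoneSp B → ℂ} {f : Linf B} (hF : Reps F f.hom) :
    0 ≤ f ↔ ∀ᶠ x in residual (StoneSp B), 0 ≤ F x := by
  constructor
  · intro h
    obtain ⟨g, rfl⟩ := CStarAlgebra.nonneg_iff_eq_star_mul_self.1 h
    obtain ⟨G, hG⟩ := g.exists_rep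
    filter_upwards [ae_eq_of_reps hF (reps_mul (reps_star hG) hG)] with x hx
    rw [hx]
    exact star_mul_self_nonneg (G x)
  · intro h
    have hm : Measurable fun x => ((Real.sqrt (F x).re : ℝ) : ℂ) :=
      Complex.measurable_ofReal.comp
        (Real.continuous_sqrt.measurable.comp (Complex.measurable_re.comp hF.measurable))
    obtain ⟨g, hg⟩ := exists_reps_of_bounded hm (C := Real.sqrt ‖f‖) (by
      filter_upwards [ae_norm_le hF] with x hx
      rw [Complex.norm_real, Real.norm_of_nonneg (Real.sqrt_nonneg _)]
      exact Real.sqrt_le_sqrt (((le_abs_self _).trans (Complex.abs_re_le_norm _)).trans hx))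
    have : f = star g * g := Linf.ext (hF.unique (reps_mul (reps_star hg) hg) (by
      filter_upwards [h] with x hx
      obtain ⟨h1, h2⟩ := Complex.nonneg_iff.1 hx
      simp only [Complex.star_def, Complex.conj_ofReal, ← Complex.ofReal_mul,
        Real.mul_self_sqrt h1]
      exact Complex.ext (by simp) (by simpa using h2.symm)))
    rw [this]
    exact star_mul_self_nonneg g

open ComplexOrder in
theorem le_iff {F G : StoneSp B → ℂ} {f g : Linf B} (hF : Reps F f.hom) (hG : Reps G g.hom) :
    f ≤ g ↔ ∀ᶠ x in residual (StoneSp B), F x ≤ G x := by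
  rw [← sub_nonneg, nonneg_iff (reps_sub hG hF)]
  simp only [sub_nonneg]

theorem chi_inf (p q : B) : chi (p ⊓ q) = chi p * chi q := by
  refine eq_of_reps (reps_chi _) (reps_mul (reps_chi p) (reps_chi q)) fun x => ?_
  rw [clop_inf]
  by_cases hp : x ∈ clop p <;> by_cases hq : x ∈ clop q <;> simp [hp, hq]

theorem chi_sup_of_disjoint {p q : B} (h : p ⊓ q = ⊥) : chi (p ⊔ q) = chi p + chi q := by
  refine eq_of_reps (reps_chi _) (reps_add (reps_chi p) (reps_chi q)) fun x => ?_
  have hx : ¬ (x ∈ clop p ∧ x ∈ clop q) := fun hx => by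
    have h' : x ∈ clop (p ⊓ q) := by rw [clop_inf]; exact hx
    simp [h, clop_bot] at h'
  rw [clop_sup]
  by_cases hp : x ∈ clop p <;> by_cases hq : x ∈ clop q <;> simp_all

theorem chi_nonneg (p : B) : 0 ≤ chi p := by
  have h : chi p = star (chi p) * chi p := by rw [star_chi, ← chi_inf, inf_idem]
  rw [h]
  exact star_mul_self_nonneg _

open ComplexOrder in
theorem chi_mono {p q : B} (h : p ≤ q) : chi p ≤ chi q := by
  refine (le_iff (reps_chi p) (reps_chi q)).2 (Eventually.of_forall fun x => ?_)
  exact indicator_le_indicator_of_subset (clop_mono h) (fun _ => zero_le_one) x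

/-! ### Simple functions and their density -/

theorem exists_simpleFunc_reps (F : SimpleFunc (StoneSp B) ℂ) : ∃ f : Linf B, Reps F f.hom := by
  obtain ⟨C, hC⟩ := F.exists_forall_norm_le
  exact exists_reps_of_bounded F.measurable (Eventually.of_forall hC)

/-- The element of `Linf B` represented by a simple function on the Stone space. -/
def ofSimpleFunc : SimpleFunc (StoneSp B) ℂ →ₗ[ℂ] Linf B where
  toFun F := (exists_simpleFunc_reps F).choose
  map_add' F G := eq_of_reps (exists_simpleFunc_reps (F + G)).choose_spec
    (reps_add (exists_simpleFunc_reps F).choose_spec (exists_simpleFunc_reps G).choose_spec)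
    fun _ => rfl
  map_smul' c F := eq_of_reps (exists_simpleFunc_reps (c • F)).choose_spec
    (reps_smul (exists_simpleFunc_reps F).choose_spec c) fun _ => rfl

theorem reps_ofSimpleFunc (F : SimpleFunc (StoneSp B) ℂ) : Reps F (ofSimpleFunc F).hom :=
  (exists_simpleFunc_reps F).choose_spec

theorem ofSimpleFunc_mul (F G : SimpleFunc (StoneSp B) ℂ) :
    ofSimpleFunc (F * G) = ofSimpleFunc F * ofSimpleFunc G :=
  eq_of_reps (reps_ofSimpleFunc _) (reps_mul (reps_ofSimpleFunc F) (reps_ofSimpleFunc G))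
    fun _ => rfl

theorem ofSimpleFunc_star (F : SimpleFunc (StoneSp B) ℂ) :
    ofSimpleFunc (F.map star) = star (ofSimpleFunc F) :=
  eq_of_reps (reps_ofSimpleFunc _) (reps_star (reps_ofSimpleFunc F)) fun _ => rfl

theorem measurableSet_clop (p : B) : MeasurableSet (clop p) := ⟨p, .rfl⟩

open Classical in
-- A measurable set differs from the clopen set of its class by a meagre set, so the two indicators
-- represent the same element.
theorem ofSimpleFunc_piecewise {s : Set (StoneSp B)} (hs : MeasurableSet s) (c : ℂ) :
    ofSimpleFunc (SimpleFunc.piecewise s hs (SimpleFunc.const _ c) (SimpleFunc.const _ 0)) =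
      c • chi (stoneClass ⟨s, hs⟩) := by
  refine eq_of_reps_ae (reps_ofSimpleFunc _) (reps_smul (reps_chi _) c) ?_
  filter_upwards [stoneClass_spec ⟨s, hs⟩] with x hx
  have hx' : x ∈ s ↔ x ∈ clop (stoneClass ⟨s, hs⟩) := iff_of_eq hx
  by_cases h : x ∈ s
  · simp [h, hx'.1 h]
  · simp [h, mt hx'.2 h]

theorem ofSimpleFunc_mem_span (F : SimpleFunc (StoneSp B) ℂ) :
    ofSimpleFunc F ∈ Submodule.span ℂ (range (chi (B := B))) := by
  classical
  induction F using SimpleFunc.induction with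
  | const c hs =>
    rw [ofSimpleFunc_piecewise]
    exact Submodule.smul_mem _ _ (Submodule.subset_span ⟨_, rfl⟩)
  | add _ hF hG => rw [map_add]; exact Submodule.add_mem _ hF hG

end Linf

/-- A bounded measurable function with values in a finite-dimensional space is a uniform limit of
simple functions. -/
theorem exists_simpleFunc_dist_le {X E : Type*} [MeasurableSpace X] [PseudoMetricSpace E]
    [ProperSpace E] [MeasurableSpace E] [OpensMeasurableSpace E] {F : X → E} (hF : Measurable F)
    (hb : Bornology.IsBounded (range F)) {ε : ℝ} (hε : 0 < ε) :
    ∃ G : SimpleFunc X E, ∀ x, dist (F x) (G x) ≤ ε := by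
  obtain ⟨t, ht, hsub⟩ := Metric.totallyBounded_iff.1
    (Metric.isCompact_of_isClosed_isBounded isClosed_closure hb.closure).totallyBounded ε hε
  rcases isEmpty_or_nonempty X with hX | ⟨⟨x₀⟩⟩
  · exact ⟨SimpleFunc.ofIsEmpty, fun x => isEmptyElim x⟩
  obtain ⟨l, hl⟩ : ∃ l : List E, ∀ y, y ∈ t → y ∈ l := ⟨ht.toFinset.toList, by simp⟩
  -- `nearestPt` also considers the index `l.length`, where the default `F x₀` is read. An
  -- additional candidate can only bring the nearest point closer, so it does no harm.
  refine ⟨(SimpleFunc.nearestPt (fun n => l.getD n (F x₀)) l.length).comp F hF, fun x => ?_⟩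
  obtain ⟨y, hy, hxy⟩ := mem_iUnion₂.1 (hsub (subset_closure (mem_range_self x)))
  obtain ⟨k, hk, rfl⟩ := List.getElem_of_mem (hl y hy)
  have h := SimpleFunc.edist_nearestPt_le (fun n => l.getD n (F x₀)) (F x) hk.le
  rw [edist_dist, edist_dist, ENNReal.ofReal_le_ofReal_iff dist_nonneg] at h
  rw [dist_comm]
  refine h.trans ?_
  rw [dist_comm, List.getD_eq_getElem _ _ hk]
  exact (Metric.mem_ball.1 hxy).le

namespace Linf

variable {B : Type*} [BooleanAlgebra B] [IsBooleanSigmaAlgebra B]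

/-- Finitely many elements of `Linf B` are simultaneously approximated by the components of
a vector-valued simple function. -/
theorem exists_simpleFunc_norm_sub_le {ι : Type*} [Fintype ι] (f : ι → Linf B) {ε : ℝ}
    (hε : 0 < ε) :
    ∃ G : SimpleFunc (StoneSp B) (ι → ℂ),
      ∀ i, ‖ofSimpleFunc (G.map fun v => v i) - f i‖ ≤ ε := by
  choose F hF hFb using fun i => (f i).exists_rep_norm_le
  obtain ⟨G, hG⟩ := exists_simpleFunc_dist_le (F := fun x i => F i x)
    (measurable_pi_lambda _ fun i => (hF i).measurable) (by
      refine (Metric.isBounded_closedBall (x := (0 : ι → ℂ)) (r := ∑ i, ‖f i‖)).subset ?_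
      rintro _ ⟨x, rfl⟩
      rw [mem_closedBall_zero_iff, pi_norm_le_iff_of_nonneg
        (Finset.sum_nonneg fun i _ => norm_nonneg _)]
      exact fun i => (hFb i x).trans
        (Finset.single_le_sum (fun i _ => norm_nonneg (f i)) (Finset.mem_univ i))) hε
  refine ⟨G, fun i => (norm_le_iff (reps_sub (reps_ofSimpleFunc _) (hF i)) hε.le).2
    (Eventually.of_forall fun x => ?_)⟩
  rw [← dist_eq_norm, dist_comm]
  exact (dist_le_pi_dist (fun i => F i x) (G x) i).trans (hG x)

theorem denseRange_ofSimpleFunc : DenseRange (ofSimpleFunc (B := B)) := by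
  refine Metric.denseRange_iff.2 fun f ε hε => ?_
  obtain ⟨G, hG⟩ := exists_simpleFunc_norm_sub_le (fun _ : Unit => f) (half_pos hε)
  refine ⟨G.map fun v => v (), ?_⟩
  rw [dist_comm, dist_eq_norm]
  exact (hG ()).trans_lt (half_lt_self hε)

theorem dense_span_chi : Dense (Submodule.span ℂ (range (chi (B := B))) : Set (Linf B)) :=
  denseRange_ofSimpleFunc.mono (range_subset_iff.2 ofSimpleFunc_mem_span)

/-- A continuous linear map on `Linf B` is determined by its values on the `chi p`. -/
theorem eq_of_eq_chi {A : Type*} [NormedAddCommGroup A] [NormedSpace ℂ A]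
    {φ ψ : Linf B →L[ℂ] A} (h : ∀ p, φ (chi p) = ψ (chi p)) : φ = ψ :=
  ContinuousLinearMap.ext_on dense_span_chi (by rintro _ ⟨p, rfl⟩; exact h p)

end Linf

/-! ### Norm bounds for combinations of a positive partition of unity -/

section Bounds

variable {A : Type*} [CStarAlgebra A] [PartialOrder A] [StarOrderedRing A]

/-- Adding `r • 1` puts the sum between `0` and `(2 * r) • 1`, where the norm is monotone. Removing
the shift costs one more `r`, hence the 3. The factor `‖1‖` covers the zero algebra. The alternative
`ν i = 0` allows for values taken only on a meagre set. -/
theorem norm_sum_real_smul_le {ι : Type*} {s : Finset ι} {t : ι → ℝ} {ν : ι → A} {r : ℝ}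
    (hν : ∀ i, 0 ≤ ν i) (hsum : ∑ i ∈ s, ν i = 1) (ht : ∀ i ∈ s, |t i| ≤ r ∨ ν i = 0) :
    ‖∑ i ∈ s, t i • ν i‖ ≤ 3 * ‖(1 : A)‖ * |r| := by
  have hr : r • (1 : A) = ∑ i ∈ s, r • ν i := by rw [← hsum, Finset.smul_sum]
  have h0 : 0 ≤ ∑ i ∈ s, t i • ν i + r • (1 : A) := by
    rw [hr, ← Finset.sum_add_distrib]
    refine Finset.sum_nonneg fun i hi => ?_
    rcases ht i hi with h | h
    · rw [← add_smul]
      exact smul_nonneg (by linarith [(abs_le.1 h).1]) (hν i)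
    · simp [h]
  have h1 : ∑ i ∈ s, t i • ν i + r • (1 : A) ≤ (2 * r) • (1 : A) := by
    rw [two_mul, add_smul]
    refine add_le_add_left ?_ _
    rw [hr]
    refine Finset.sum_le_sum fun i hi => ?_
    rcases ht i hi with h | h
    · exact smul_le_smul_of_nonneg_right (abs_le.1 h).2 (hν i)
    · simp [h]
  have h2 := CStarAlgebra.norm_le_norm_of_nonneg_of_le h0 h1
  calc ‖∑ i ∈ s, t i • ν i‖ = ‖(∑ i ∈ s, t i • ν i + r • (1 : A)) - r • (1 : A)‖ := by
        rw [add_sub_cancel_right]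
    _ ≤ ‖(2 * r) • (1 : A)‖ + ‖r • (1 : A)‖ := (norm_sub_le _ _).trans (by gcongr)
    _ = 3 * ‖(1 : A)‖ * |r| := by
        rw [norm_smul, norm_smul, Real.norm_eq_abs, Real.norm_eq_abs, abs_mul, abs_two]; ring

/-- The real bound is applied to real and imaginary parts, which doubles the constant. Any bound
proportional to `r` suffices for the extension by continuity. -/
theorem norm_sum_smul_le {ι : Type*} {s : Finset ι} {c : ι → ℂ} {ν : ι → A} {r : ℝ}
    (hν : ∀ i, 0 ≤ ν i) (hsum : ∑ i ∈ s, ν i = 1) (hr : 0 ≤ r)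
    (hc : ∀ i ∈ s, ‖c i‖ ≤ r ∨ ν i = 0) :
    ‖∑ i ∈ s, c i • ν i‖ ≤ 6 * ‖(1 : A)‖ * r := by
  have hre := norm_sum_real_smul_le (t := fun i => (c i).re) hν hsum fun i hi =>
    (hc i hi).imp_left (Complex.abs_re_le_norm _).trans
  have him := norm_sum_real_smul_le (t := fun i => (c i).im) hν hsum fun i hi =>
    (hc i hi).imp_left (Complex.abs_im_le_norm _).trans
  have h : ∑ i ∈ s, c i • ν i =
      ∑ i ∈ s, (c i).re • ν i + Complex.I • ∑ i ∈ s, (c i).im • ν i := by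
    rw [Finset.smul_sum, ← Finset.sum_add_distrib]
    refine Finset.sum_congr rfl fun i _ => ?_
    conv_lhs => rw [← Complex.re_add_im (c i), add_smul, mul_comm, mul_smul, Complex.coe_smul,
      Complex.coe_smul]
  rw [h]
  refine (norm_add_le _ _).trans ?_
  rw [norm_smul, Complex.norm_I, one_mul]
  rw [abs_of_nonneg hr] at hre him
  linarith

end Bounds

/-- Serves to factor positive elements of the matrix algebra over `Linf B`. -/
theorem exists_eq_star_mul_self_of_nonneg {A : Type*} [NonUnitalCStarAlgebra A] [PartialOrder A]
    [StarOrderedRing A] {a : A} (ha : 0 ≤ a) : ∃ b, a = star b * b :=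
  CStarAlgebra.nonneg_iff_eq_star_mul_self.1 ha

/-! ### Additivity of a POVM and its transport to the Stone space -/

namespace IsPOVM

section OnStone

variable {B : Type*} [BooleanAlgebra B] [IsBooleanSigmaAlgebra B] {A : Type*} [CStarAlgebra A]
  {μ : B → A}

open Classical in
/-- The finitely additive measure on the Stone space induced by `μ`; it is zero on
non-measurable sets. -/
def onStone (μ : B → A) (s : Set (StoneSp B)) : A :=
  if hs : MeasurableSet s then μ (stoneClass ⟨s, hs⟩) else 0

theorem onStone_of_ae {s : Set (StoneSp B)} {p : B} (h : s =ᶠ[residual _] clop p) :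
    onStone μ s = μ p := by
  have hs : MeasurableSet s := ⟨p, h⟩
  rw [onStone, dif_pos hs, stoneClass_eq (S := ⟨s, hs⟩) h]

/-- The measure of a set as a linear map `c ↦ c • onStone μ s`. -/
def onStoneL (μ : B → A) (s : Set (StoneSp B)) : ℂ →L[ℝ] A :=
  (ContinuousLinearMap.toSpanSingleton ℂ (onStone μ s)).restrictScalars ℝ

@[simp] theorem onStoneL_apply (s : Set (StoneSp B)) (c : ℂ) :
    onStoneL μ s c = c • onStone μ s := rfl

end OnStone

variable {B : Type*} [BooleanAlgebra B] {A : Type*} [CStarAlgebra A] [PartialOrder A]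
  [StarOrderedRing A] {μ : B → A}

theorem map_bot (h : IsPOVM μ) : μ ⊥ = 0 := by
  have hs := h.sigma_additive (fun _ => ⊥) ⊥ (by simp) (by simp)
  -- The constant sequence `⊥` is pairwise disjoint, so two of its terms already form a partial sum
  -- below `μ ⊥`.
  have h2 : μ ⊥ + μ ⊥ ≤ μ ⊥ := hs.1 ⟨{0, 1}, by simp [two_mul]⟩
  exact le_antisymm (by simpa using h2) (h.nonneg ⊥)

/-- Apply σ-additivity to `p, q, ⊥, ⊥, …`: the later terms vanish, so the partial sum over `{0, 1}`
is the largest. -/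
theorem map_sup (h : IsPOVM μ) {p q : B} (hpq : p ⊓ q = ⊥) : μ (p ⊔ q) = μ p + μ q := by
  let u : ℕ → B := fun n => if n = 0 then p else if n = 1 then q else ⊥
  have hu : IsLUB (range u) (p ⊔ q) := by
    refine ⟨?_, fun b hb => sup_le (hb ⟨0, rfl⟩) (hb ⟨1, rfl⟩)⟩
    rintro _ ⟨n, rfl⟩
    simp only [u]
    split_ifs <;> simp
  have hd : ∀ m n, m ≠ n → u m ⊓ u n = ⊥ := by
    intro m n hmn
    simp only [u]
    split_ifs <;> simp_all [inf_comm]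
  have hν : ∀ n, n ≠ 0 → n ≠ 1 → μ (u n) = 0 := fun n h0 h1 => by simp [u, h0, h1, h.map_bot]
  refine (h.sigma_additive u _ hd hu).unique ⟨?_, fun b hb => ?_⟩
  · rintro _ ⟨F, rfl⟩
    have h1 : ∑ i ∈ F, μ (u i) ≤ ∑ i ∈ F ∪ {0, 1}, μ (u i) :=
      Finset.sum_le_sum_of_subset_of_nonneg Finset.subset_union_left fun i _ _ => h.nonneg _
    have h2 : ∑ i ∈ ({0, 1} : Finset ℕ), μ (u i) = ∑ i ∈ F ∪ {0, 1}, μ (u i) :=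
      Finset.sum_subset Finset.subset_union_right fun i _ hi => by
        simp only [Finset.mem_insert, Finset.mem_singleton, not_or] at hi
        exact hν i hi.1 hi.2
    rw [← h2] at h1
    simpa [u] using h1
  · simpa [u] using hb ⟨{0, 1}, rfl⟩

theorem mono (h : IsPOVM μ) {p q : B} (hpq : p ≤ q) : μ p ≤ μ q := by
  have := h.map_sup (inf_sdiff_self_right : p ⊓ (q \ p) = ⊥)
  rw [sup_sdiff_cancel_right hpq] at this
  rw [this]
  exact le_add_of_nonneg_right (h.nonneg _)

/-- A positive operator valued measure is continuous from below. -/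
theorem isLUB_of_monotone (h : IsPOVM μ) {d : ℕ → B} {s : B} (hd : Monotone d)
    (hs : IsLUB (range d) s) : IsLUB (range fun n => μ (d n)) (μ s) := by
  -- The increments of `d` are disjoint, have the same supremum as `d`, and their measures telescope
  -- to `μ (d n)`.
  have hps : partialSups (disjointed d) = partialSups d := partialSups_disjointed d
  have hsum : ∀ n, ∑ i ∈ Finset.range (n + 1), μ (disjointed d i) = μ (d n) := by
    intro n
    induction n with
    | zero => simp
    | succ n ih =>
      rw [Finset.sum_range_succ, ih, ← h.map_sup]
      · rw [sup_comm]
        exact congrArg μ (hd.disjointed_succ_sup n)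
      · refine (congrArg (d n ⊓ ·) (hd.disjointed_succ (not_isMax n))).trans ?_
        exact inf_sdiff_self_right
  have hlub : IsLUB (range (disjointed d)) s := by
    refine ⟨?_, fun b hb => hs.2 ?_⟩
    · rintro _ ⟨n, rfl⟩
      exact (disjointed_le d n).trans (hs.1 ⟨n, rfl⟩)
    · rintro _ ⟨n, rfl⟩
      refine (le_partialSups d n).trans ?_
      rw [← hps]
      exact partialSups_le _ _ _ fun k _ => hb ⟨k, rfl⟩
  have hadd := h.sigma_additive _ s
    (fun m n hmn => disjoint_iff.1 (disjoint_disjointed d hmn)) hlub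
  refine ⟨?_, fun b hb => hadd.2 ?_⟩
  · rintro _ ⟨n, rfl⟩
    exact h.mono (hs.1 ⟨n, rfl⟩)
  · rintro _ ⟨F, rfl⟩
    -- A partial sum over `F` is dominated by the sum up to the largest index in `F`, which
    -- telescopes.
    refine le_trans ?_ (hb ⟨F.sup id, rfl⟩)
    change _ ≤ μ (d _)
    rw [← hsum]
    refine Finset.sum_le_sum_of_subset_of_nonneg (fun i hi => ?_) fun i _ _ => h.nonneg _
    exact Finset.mem_range.2 (Nat.lt_succ_of_le (Finset.le_sup (f := id) hi))

variable [IsBooleanSigmaAlgebra B]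

omit [StarOrderedRing A] in
theorem onStone_nonneg (h : IsPOVM μ) (s : Set (StoneSp B)) : 0 ≤ onStone μ s := by
  rw [onStone]
  split_ifs
  exacts [h.nonneg _, le_rfl]

theorem onStone_union (h : IsPOVM μ) {s t : Set (StoneSp B)} (hs : MeasurableSet s)
    (ht : MeasurableSet t) (hst : Disjoint s t) :
    onStone μ (s ∪ t) = onStone μ s + onStone μ t := by
  obtain ⟨p, hp⟩ := hs
  obtain ⟨q, hq⟩ := ht
  -- Disjoint sets have disjoint classes: the clopen set of `p ⊓ q` is meagre, hence empty by the
  -- Baire property.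
  have hpq : p ⊓ q = ⊥ := eq_of_clop_eventuallyEq (by
    rw [clop_inf, clop_bot, ← disjoint_iff_inter_eq_empty.1 hst]
    exact (hp.inter hq).symm)
  rw [onStone_of_ae hp, onStone_of_ae hq, ← h.map_sup hpq]
  exact onStone_of_ae (by rw [clop_sup]; exact hp.union hq)

/-- The reference measure `0` makes the finiteness and integrability side conditions of
`setToSimpleFunc` trivial. Only finite additivity remains. -/
theorem finMeasAdditive_onStoneL (h : IsPOVM μ) :
    FinMeasAdditive (0 : Measure (StoneSp B)) (onStoneL μ) := by
  intro s t hs ht _ _ hst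
  refine ContinuousLinearMap.ext fun c => ?_
  simp [onStone_union h hs ht hst]

/-! ### The integral and its continuous extension -/

/-- Integration of simple functions on the Stone space. -/
def simpleIntegral (h : IsPOVM μ) : SimpleFunc (StoneSp B) ℂ →ₗ[ℂ] A where
  toFun F := F.setToSimpleFunc (onStoneL μ)
  map_add' _ _ := SimpleFunc.setToSimpleFunc_add _ h.finMeasAdditive_onStoneL
    integrable_zero_measure integrable_zero_measure
  map_smul' c _ := SimpleFunc.setToSimpleFunc_smul _ h.finMeasAdditive_onStoneL
    (fun c s x => by simp [mul_smul]) c integrable_zero_measure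

theorem simpleIntegral_apply (h : IsPOVM μ) (F : SimpleFunc (StoneSp B) ℂ) :
    h.simpleIntegral F = ∑ c ∈ F.range, c • onStone μ (F ⁻¹' {c}) := rfl

/-- Lets several scalar functions of one vector-valued `G`, such as matrix entries, be integrated
over the same partition into fibres. -/
theorem simpleIntegral_map (h : IsPOVM μ) {E : Type*} [NormedAddCommGroup E]
    (G : SimpleFunc (StoneSp B) E) {g : E → ℂ} (hg : g 0 = 0) :
    h.simpleIntegral (G.map g) = ∑ v ∈ G.range, g v • onStone μ (G ⁻¹' {v}) :=
  SimpleFunc.map_setToSimpleFunc _ h.finMeasAdditive_onStoneL integrable_zero_measure hg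

theorem sum_onStone_fiber (h : IsPOVM μ) (F : SimpleFunc (StoneSp B) ℂ) :
    ∑ c ∈ F.range, onStone μ (F ⁻¹' {c}) = 1 := by
  have hadd := h.finMeasAdditive_onStoneL
  have := hadd.map_iUnion_fin_meas_set_eq_sum _ hadd.map_empty_eq_zero (fun c : ℂ => F ⁻¹' {c})
    F.range (fun c => F.measurableSet_fiber c) (by simp) (by
      intro i _ j _ hij
      exact Disjoint.preimage _ (by simpa using hij))
  have hU : (⋃ c ∈ F.range, F ⁻¹' {c}) = univ := by
    ext x
    simp
  rw [hU] at this
  have h1 := congrArg (fun T : ℂ →L[ℝ] A => T 1) this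
  simp only [onStoneL_apply, one_smul, _root_.sum_apply] at h1
  rw [← h1, onStone_of_ae (p := ⊤) (by rw [clop_top]; rfl), h.map_top]

/-- The bound is by the essential norm, not the supremum of `F`, so the integral depends only on the
class of `F` and extends along `Linf.ofSimpleFunc`. Values above the essential norm have meagre
fibres, which have measure `μ ⊥ = 0`. -/
theorem norm_simpleIntegral_le (h : IsPOVM μ) (F : SimpleFunc (StoneSp B) ℂ) :
    ‖h.simpleIntegral F‖ ≤ 6 * ‖(1 : A)‖ * ‖Linf.ofSimpleFunc F‖ := by
  rw [simpleIntegral_apply]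
  refine norm_sum_smul_le (fun c => h.onStone_nonneg _) (h.sum_onStone_fiber F) (norm_nonneg _)
    fun c _ => ?_
  by_cases hc : ‖c‖ ≤ ‖Linf.ofSimpleFunc F‖
  · exact Or.inl hc
  · right
    rw [onStone_of_ae (p := ⊥), h.map_bot]
    rw [clop_bot]
    filter_upwards [Linf.ae_norm_le (Linf.reps_ofSimpleFunc F)] with x hx
    refine eq_false fun hxc => hc ?_
    have hxc' : F x = c := hxc
    rwa [hxc'] at hx

/-- The integral of a positive operator valued measure, as a continuous linear map. -/
def integral (h : IsPOVM μ) : Linf B →L[ℂ] A := h.simpleIntegral.extendOfNorm Linf.ofSimpleFunc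

theorem integral_ofSimpleFunc (h : IsPOVM μ) (F : SimpleFunc (StoneSp B) ℂ) :
    h.integral (Linf.ofSimpleFunc F) = h.simpleIntegral F :=
  LinearMap.extendOfNorm_eq Linf.denseRange_ofSimpleFunc ⟨_, h.norm_simpleIntegral_le⟩ F

theorem integral_chi (h : IsPOVM μ) (p : B) : h.integral (Linf.chi p) = μ p := by
  classical
  have hp := Linf.measurableSet_clop p
  have h1 := Linf.ofSimpleFunc_piecewise hp 1
  rw [one_smul, stoneClass_eq (S := ⟨clop p, hp⟩) .rfl] at h1
  rw [← h1, integral_ofSimpleFunc]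
  refine (SimpleFunc.setToSimpleFunc_indicator _
    h.finMeasAdditive_onStoneL.map_empty_eq_zero hp 1).trans ?_
  rw [onStoneL_apply, one_smul, onStone_of_ae .rfl]

/-! ### Complete positivity of the integral -/

/-- The matrix of integrals of `star G * G`, for a matrix-valued simple function `G`, is
positive. -/
theorem map_integral_star_mul_self_nonneg (h : IsPOVM μ) {k : ℕ}
    (G : SimpleFunc (StoneSp B) (Fin k × Fin k → ℂ)) (N : CStarMatrix (Fin k) (Fin k) (Linf B))
    (hN : ∀ i j, N i j = Linf.ofSimpleFunc (G.map fun v => v (i, j))) :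
    0 ≤ (star N * N).map h.integral := by
  -- On the fibre over `v` the integrand is a constant scalar matrix. Giving each factor a square
  -- root of the fibre's measure makes its contribution exactly `star (R v) * R v`.
  let R : (Fin k × Fin k → ℂ) → CStarMatrix (Fin k) (Fin k) A := fun v =>
    CStarMatrix.ofMatrix fun i j => v (i, j) • CFC.sqrt (onStone μ (G ⁻¹' {v}))
  have key : (star N * N).map h.integral = ∑ v ∈ G.range, star (R v) * R v := by
    ext i j
    have hsum : (∑ v ∈ G.range, star (R v) * R v) i j
        = ∑ v ∈ G.range, (star (R v) * R v) i j := by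
      exact Matrix.sum_apply i j _ _
    have hl : (star N * N) i j =
        Linf.ofSimpleFunc (G.map fun v => ∑ m, star (v (m, i)) * v (m, j)) := by
      have hF : (G.map fun v => ∑ m, star (v (m, i)) * v (m, j)) =
          ∑ m, (G.map fun v => v (m, i)).map star * G.map fun v => v (m, j) := by
        ext x
        let ev : SimpleFunc (StoneSp B) ℂ →+ ℂ :=
          { toFun := fun F => F x, map_zero' := rfl, map_add' := fun _ _ => rfl }
        exact (map_sum ev (fun m => (G.map fun v => v (m, i)).map star *
          G.map fun v => v (m, j)) Finset.univ).symm
      rw [hF, map_sum, CStarMatrix.mul_apply]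
      refine Finset.sum_congr rfl fun m _ => ?_
      rw [Linf.ofSimpleFunc_mul, Linf.ofSimpleFunc_star, ← hN, ← hN]
      rfl
    rw [CStarMatrix.map_apply, hl, integral_ofSimpleFunc, h.simpleIntegral_map G (by simp), hsum]
    refine Finset.sum_congr rfl fun v _ => ?_
    rw [CStarMatrix.mul_apply, Finset.sum_smul]
    refine Finset.sum_congr rfl fun m _ => ?_
    have hs : star (CFC.sqrt (onStone μ (G ⁻¹' {v}))) = CFC.sqrt (onStone μ (G ⁻¹' {v})) :=
      (IsSelfAdjoint.of_nonneg (CFC.sqrt_nonneg _)).star_eq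
    change _ = star (v (m, i) • CFC.sqrt (onStone μ (G ⁻¹' {v}))) *
      (v (m, j) • CFC.sqrt (onStone μ (G ⁻¹' {v})))
    rw [star_smul, hs, smul_mul_smul_comm, CFC.sqrt_mul_sqrt_self _ (h.onStone_nonneg _)]
  rw [key]
  exact Finset.sum_nonneg fun v _ => star_mul_self_nonneg (R v)

/-- Write `M = star N * N` and approximate all entries of `N` by one vector-valued simple function.
Matrix convergence is entrywise, the integral is continuous, and the positive cone is closed. -/
theorem map_integral_nonneg (h : IsPOVM μ) {k : ℕ} (M : CStarMatrix (Fin k) (Fin k) (Linf B))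
    (hM : 0 ≤ M) : 0 ≤ M.map h.integral := by
  obtain ⟨N, rfl⟩ := exists_eq_star_mul_self_of_nonneg hM
  choose G hG using fun n : ℕ => Linf.exists_simpleFunc_norm_sub_le
    (fun ij : Fin k × Fin k => N ij.1 ij.2) (Nat.one_div_pos_of_nat (α := ℝ) (n := n))
  let N' : ℕ → CStarMatrix (Fin k) (Fin k) (Linf B) := fun n =>
    CStarMatrix.ofMatrix fun i j => Linf.ofSimpleFunc ((G n).map fun v => v (i, j))
  have hN' : ∀ i j, Tendsto (fun n => N' n i j) atTop (𝓝 (N i j)) := fun i j => by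
    rw [tendsto_iff_norm_sub_tendsto_zero]
    exact squeeze_zero (fun _ => norm_nonneg _) (fun n => hG n (i, j))
      tendsto_one_div_add_atTop_nhds_zero_nat
  have hlim : Tendsto (fun n => (star (N' n) * N' n).map h.integral) atTop
      (𝓝 ((star N * N).map h.integral)) := by
    refine tendsto_pi_nhds.2 fun i => tendsto_pi_nhds.2 fun j => ?_
    change Tendsto (fun n => h.integral ((star (N' n) * N' n) i j)) atTop
      (𝓝 (h.integral ((star N * N) i j)))
    refine (h.integral.continuous.tendsto _).comp ?_
    simp only [CStarMatrix.mul_apply, CStarMatrix.star_apply]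
    exact tendsto_finsetSum _ fun m _ => (hN' m i).star.mul (hN' m j)
  exact ge_of_tendsto' hlim fun n =>
    h.map_integral_star_mul_self_nonneg (G n) (N' n) fun _ _ => rfl

/-- The integral of a positive operator valued measure, as a completely positive map. -/
def integralCP (h : IsPOVM μ) : Linf B →CP A where
  toLinearMap := h.integral.toLinearMap
  map_cstarMatrix_nonneg' _ M hM := h.map_integral_nonneg M hM

end IsPOVM

/-! ### Uniqueness, and increasing sequences in `Linf B` -/

section

variable {B : Type*} [BooleanAlgebra B] [IsBooleanSigmaAlgebra B] {A : Type*} [CStarAlgebra A]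
  [PartialOrder A] [StarOrderedRing A]

/-- Positive linear maps on `Linf B` are determined by their values on the `chi p`. -/
theorem Linf.eq_of_positive_of_eq_chi {F G : Type*} [FunLike F (Linf B) A]
    [LinearMapClass F ℂ (Linf B) A] [OrderHomClass F (Linf B) A] [FunLike G (Linf B) A]
    [LinearMapClass G ℂ (Linf B) A] [OrderHomClass G (Linf B) A] {φ : F} {ψ : G}
    (h : ∀ p, φ (Linf.chi p) = ψ (Linf.chi p)) (f : Linf B) : φ f = ψ f :=
  DFunLike.congr_fun (Linf.eq_of_eq_chi
    -- Positive linear maps between C⋆-algebras are automatically continuous, so density of the span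
    -- applies.
    (φ := { toLinearMap := (φ : Linf B →ₗ[ℂ] A), cont := map_continuous φ })
    (ψ := { toLinearMap := (ψ : Linf B →ₗ[ℂ] A), cont := map_continuous ψ }) h) f

theorem Linf.sum_chi {p : ℕ → B} (hd : ∀ m n, m ≠ n → p m ⊓ p n = ⊥) (F : Finset ℕ) :
    ∑ i ∈ F, Linf.chi (p i) = Linf.chi (F.sup p) := by
  classical
  induction F using Finset.induction_on with
  | empty => simp [Linf.chi_bot]
  | insert i F hi ih =>
    rw [Finset.sum_insert hi, ih, Finset.sup_insert, Linf.chi_sup_of_disjoint]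
    refine disjoint_iff.1 (Finset.disjoint_sup_right.2 fun j hj => disjoint_iff.2 (hd i j ?_))
    rintro rfl
    exact hi hj

open ComplexOrder in
/-- `chi` is continuous from below. -/
theorem Linf.increasesTo_chi {d : ℕ → B} {s : B} (hd : Monotone d) (hs : IsLUB (range d) s) :
    IncreasesTo (fun n => (⟨Linf.chi (d n), Linf.star_chi _⟩ : selfAdjoint (Linf B)))
      ⟨Linf.chi s, Linf.star_chi s⟩ := by
  refine ⟨fun m n hmn => Linf.chi_mono (hd hmn), ⟨1, fun n => ?_⟩, ?_, ?_⟩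
  · exact Linf.norm_chi_le (d n)
  · rintro _ ⟨n, rfl⟩
    exact Linf.chi_mono (hs.1 ⟨n, rfl⟩)
  · rintro ⟨g, hg⟩ hub
    obtain ⟨G, hG⟩ := g.exists_rep
    have hle : ∀ n, Linf.chi (d n) ≤ g := fun n => by
      have h := hub (mem_range_self n)
      exact h
    refine (Linf.le_iff (Linf.reps_chi s) hG).2 ?_
    -- Off one meagre set, all countably many inequalities hold at once and `clop s` is the union of
    -- the `clop (d n)`.
    filter_upwards [clop_isLUB hs, eventually_countable_forall.2 fun n =>
      (Linf.le_iff (Linf.reps_chi (d n)) hG).1 (hle n)] with x hx hn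
    by_cases hxs : x ∈ clop s
    · obtain ⟨n, hxn⟩ := mem_iUnion.1 (hx.mp hxs)
      have := hn n
      rw [indicator_of_mem hxn] at this
      rw [indicator_of_mem hxs]
      exact this
    · rw [indicator_of_notMem hxs]
      exact (indicator_nonneg (fun _ _ => zero_le_one) x).trans (hn 0)

open ComplexOrder in
/-- If `a n ↗ s` then point maps representing the `a n` increase almost everywhere to any point map
representing `s`. -/
theorem Linf.ae_exists_of_increasesTo {a : ℕ → selfAdjoint (Linf B)}
    {s : selfAdjoint (Linf B)} (has : IncreasesTo a s) {F : ℕ → StoneSp B → ℂ}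
    {G : StoneSp B → ℂ} (hF : ∀ n, Reps (F n) (a n : Linf B).hom)
    (hFb : ∀ n x, ‖F n x‖ ≤ ‖(a n : Linf B)‖) (hG : Reps G (s : Linf B).hom) {ε : ℝ}
    (hε : 0 < ε) : ∀ᶠ x in residual (StoneSp B), ∃ n, (G x).re ≤ (F n x).re + ε := by
  obtain ⟨-, ⟨C, hC⟩, hlub⟩ := has
  have hFC : ∀ n x, (F n x).re ≤ C := fun n x =>
    (Complex.re_le_norm _).trans ((hFb n x).trans (hC n))
  have hbdd : ∀ x, BddAbove (range fun n => (F n x).re) := fun x =>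
    ⟨C, by rintro _ ⟨n, rfl⟩; exact hFC n x⟩
  -- The pointwise supremum represents a self-adjoint upper bound `h` of the `a n`. As `s` is the
  -- least one, `G` lies below the pointwise supremum almost everywhere.
  have hm : Measurable fun x => ((⨆ n, (F n x).re : ℝ) : ℂ) :=
    Complex.measurable_ofReal.comp
      (Measurable.iSup fun n => Complex.measurable_re.comp (hF n).measurable)
  obtain ⟨h, hh⟩ := Linf.exists_reps_of_bounded hm (C := C) (Eventually.of_forall fun x => by
    rw [Complex.norm_real, Real.norm_eq_abs, abs_le]
    refine ⟨?_, ciSup_le fun n => hFC n x⟩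
    refine le_trans ?_ (le_ciSup (hbdd x) 0)
    have := (Complex.abs_re_le_norm _).trans ((hFb 0 x).trans (hC 0))
    exact (abs_le.1 this).1)
  have hsa : star h = h := Linf.eq_of_reps (Linf.reps_star hh) hh fun x => by simp
  have hle : s ≤ ⟨h, hsa⟩ := hlub.2 (by
    rintro _ ⟨n, rfl⟩
    refine (Linf.le_iff (hF n) hh).2 ?_
    have hst : star (a n : Linf B) = a n := (a n).2
    have hst' := Linf.reps_star (hF n)
    rw [hst] at hst'
    filter_upwards [Linf.ae_eq_of_reps hst' (hF n)] with x hx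
    rw [Complex.le_def]
    refine ⟨le_ciSup (hbdd x) n, ?_⟩
    rw [Complex.ofReal_im]
    exact Complex.conj_eq_iff_im.1 hx)
  filter_upwards [(Linf.le_iff hG hh).1 hle] with x hx
  obtain ⟨n, hn⟩ := exists_lt_of_lt_ciSup (sub_lt_self (⨆ n, (F n x).re) hε)
  have h1 : (G x).re ≤ ⨆ n, (F n x).re := (Complex.le_def.1 hx).1
  exact ⟨n, by linarith⟩

open ComplexOrder in
/-- Egorov-type estimate: an increasing sequence is uniformly close to its supremum off an element
of `B` that decreases to `⊥`. -/
theorem Linf.exists_le_add_chi_compl {a : ℕ → selfAdjoint (Linf B)}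
    {s : selfAdjoint (Linf B)} (has : IncreasesTo a s) {ε : ℝ} (hε : 0 < ε) :
    ∃ (d : ℕ → B) (K : ℝ), 0 < K ∧ Monotone d ∧ IsLUB (range d) ⊤ ∧
      ∀ n, (s : Linf B) ≤ a n + (ε : ℂ) • (1 : Linf B) + (K : ℂ) • (1 - Linf.chi (d n)) := by
  choose F hF hFb using fun n => (a n : Linf B).exists_rep_norm_le
  obtain ⟨G, hG, hGb⟩ := (s : Linf B).exists_rep_norm_le
  have hex := Linf.ae_exists_of_increasesTo has hF hFb hG hε
  obtain ⟨hmono, ⟨C, hC⟩, hlub⟩ := has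
  have hC0 : 0 ≤ C := (norm_nonneg _).trans (hC 0)
  have hU : ∀ n, MeasurableSet {x | (G x).re ≤ (F n x).re + ε} := fun n =>
    measurableSet_le (Complex.measurable_re.comp hG.measurable)
      ((Complex.measurable_re.comp (hF n).measurable).add_const ε)
  let U : ℕ → MSet (StoneSp B) := fun n => ⟨_, hU n⟩
  have hspec : ∀ n, ∀ᶠ x in residual (StoneSp B),
      (G x).re ≤ (F n x).re + ε ↔ x ∈ clop (stoneClass (U n)) := fun n => by
    filter_upwards [stoneClass_spec (U n)] with x hx
    exact iff_of_eq hx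
  -- `d n` is the class of the set where `G` exceeds `F n` by at most `ε`. Elsewhere the excess is
  -- at most `‖s‖ + C`, and the extra 1 keeps `K` positive.
  refine ⟨fun n => stoneClass (U n), ‖(s : Linf B)‖ + C + 1, by positivity, ?_, ?_, fun n => ?_⟩
  · refine monotone_nat_of_le_succ fun n => le_of_clop_eventuallyLE ?_
    filter_upwards [hspec n, hspec (n + 1),
      (Linf.le_iff (hF n) (hF (n + 1))).1 (hmono n.le_succ)] with x h1 h2 h3 hx
    refine h2.1 ((h1.2 hx).trans ?_)
    have := (Complex.le_def.1 h3).1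
    linarith
  · have h1 := (stoneHom (B := B)).map_isLUB ((isLUB_mset_iff U ⟨_, .iUnion fun n => (U n).2⟩).2 rfl)
    have h2 : stoneHom (⟨_, .iUnion fun n => (U n).2⟩ : MSet (StoneSp B)) = ⊤ :=
      stoneClass_eq (by
        rw [clop_top]
        filter_upwards [hex] with x hx
        exact eq_true (mem_iUnion.2 hx))
    rw [h2] at h1
    exact h1
  · refine (Linf.le_iff hG (Linf.reps_add (Linf.reps_add (hF n) (Linf.reps_smul Linf.reps_one _))
      (Linf.reps_smul (Linf.reps_sub Linf.reps_one (Linf.reps_chi _)) _))).2 ?_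
    have him : ∀ {t : selfAdjoint (Linf B)} {H : StoneSp B → ℂ}, Reps H (t : Linf B).hom →
        ∀ᶠ x in residual (StoneSp B), (H x).im = 0 := fun {t H} hH => by
      have hst : star (t : Linf B) = t := t.2
      have hst' := Linf.reps_star hH
      rw [hst] at hst'
      filter_upwards [Linf.ae_eq_of_reps hst' hH] with x hx
      exact Complex.conj_eq_iff_im.1 hx
    filter_upwards [hspec n, him hG, him (hF n)] with x hx hg hf
    by_cases hxd : x ∈ clop (stoneClass (U n))
    · have := hx.2 hxd
      simp [Complex.le_def, indicator_of_mem hxd, hg, hf, this]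
    · have h1 := (Complex.re_le_norm _).trans (hGb x)
      have h2 := (abs_le.1 ((Complex.abs_re_le_norm _).trans ((hFb n x).trans (hC n)))).1
      simp only [Complex.le_def, indicator_of_notMem hxd]
      simp [hg, hf]
      linarith

omit [StarOrderedRing A] in
/-- A unital σ-normal positive map restricts to a positive operator valued measure. -/
theorem isPOVM_of_isSigmaNormal {F : Type*} [FunLike F (Linf B) A]
    [LinearMapClass F ℂ (Linf B) A] [OrderHomClass F (Linf B) A] {φ : F} (h1 : φ 1 = 1)
    (hφ : IsSigmaNormal φ) : IsPOVM fun p : B => φ (Linf.chi p) where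
  nonneg p := by
    rw [← map_zero φ]
    exact OrderHomClass.mono φ (Linf.chi_nonneg p)
  map_top := by rw [Linf.chi_top, h1]
  sigma_additive p s hd hs := by
    have hsum : ∀ F : Finset ℕ, ∑ i ∈ F, φ (Linf.chi (p i)) = φ (Linf.chi (F.sup p)) := fun F => by
      rw [← map_sum, Linf.sum_chi hd]
    -- σ-normality concerns increasing sequences, whereas an order sum runs over all finite sets.
    -- Joins over initial segments give a sequence with the same supremum.
    have hmono : Monotone fun n => (Finset.range n).sup p := fun m n hmn =>
      Finset.sup_mono (Finset.range_mono hmn)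
    have hlub : IsLUB (range fun n => (Finset.range n).sup p) s := by
      refine ⟨?_, fun b hb => hs.2 ?_⟩
      · rintro _ ⟨n, rfl⟩
        exact Finset.sup_le fun i _ => hs.1 ⟨i, rfl⟩
      · rintro _ ⟨n, rfl⟩
        exact (Finset.le_sup (f := p) (Finset.self_mem_range_succ n)).trans (hb ⟨n + 1, rfl⟩)
    have key := hφ _ _ (Linf.increasesTo_chi hmono hlub)
    refine ⟨?_, fun b hb => key.2 ?_⟩
    · rintro _ ⟨F, rfl⟩
      refine (hsum F).trans_le (OrderHomClass.mono φ (Linf.chi_mono ?_))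
      exact Finset.sup_le fun i _ => hs.1 ⟨i, rfl⟩
    · rintro _ ⟨n, rfl⟩
      exact (hsum (Finset.range n)).symm.trans_le (hb ⟨Finset.range n, rfl⟩)

end

/-! ### σ-normality of the integral -/

namespace IsPOVM

variable {B : Type*} [BooleanAlgebra B] [IsBooleanSigmaAlgebra B] {A : Type*} [CStarAlgebra A]
  [PartialOrder A] [StarOrderedRing A] {μ : B → A}

theorem integral_one (h : IsPOVM μ) : h.integral 1 = 1 := by
  rw [← Linf.chi_top, h.integral_chi, h.map_top]

theorem monotone_integral (h : IsPOVM μ) : Monotone h.integral :=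
  OrderHomClass.mono h.integralCP

/-- Integrating the Egorov-type estimate bounds the integral of `s` by `b + ε + K (1 - μ (d n))` for
any upper bound `b`. The last term need not tend to `0` in norm, so order continuity of `μ` must
remove it. -/
theorem isSigmaNormal_integral (h : IsPOVM μ) : IsSigmaNormal h.integral := by
  intro a s has
  refine ⟨?_, fun b hb => ?_⟩
  · rintro _ ⟨n, rfl⟩
    exact h.monotone_integral (has.2.2.1 ⟨n, rfl⟩)
  have hε : ∀ ε : ℝ, 0 < ε → h.integral s ≤ b + ε • (1 : A) := by
    intro ε hε
    obtain ⟨d, K, hK, hd, hlub, hle⟩ := Linf.exists_le_add_chi_compl has hε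
    -- Solved for `μ (d n)`, the estimate has a right side independent of `n`. It therefore bounds
    -- the supremum `μ ⊤ = 1`.
    have hn : ∀ n, μ (d n) ≤ K⁻¹ • (b + ε • (1 : A) + K • (1 : A) - h.integral s) := fun n => by
      have h1 := h.monotone_integral (hle n)
      simp only [map_add, map_smul, map_sub, integral_one, integral_chi] at h1
      simp only [Complex.coe_smul] at h1
      have h2 : h.integral (a n) ≤ b := hb ⟨n, rfl⟩
      have h3 : K • μ (d n) ≤ b + ε • (1 : A) + K • (1 : A) - h.integral s := by
        rw [smul_sub] at h1
        rw [le_sub_iff_add_le]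
        calc K • μ (d n) + h.integral s
            ≤ K • μ (d n) + (h.integral (a n) + ε • (1 : A) + (K • (1 : A) - K • μ (d n))) := by
              gcongr
          _ = h.integral (a n) + ε • (1 : A) + K • (1 : A) := by abel
          _ ≤ b + ε • (1 : A) + K • (1 : A) := by gcongr
      calc μ (d n) = K⁻¹ • K • μ (d n) := by rw [smul_smul, inv_mul_cancel₀ hK.ne', one_smul]
        _ ≤ _ := smul_le_smul_of_nonneg_left h3 (inv_nonneg.2 hK.le)
    have h1 := (h.isLUB_of_monotone hd hlub).2 (by rintro _ ⟨n, rfl⟩; exact hn n)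
    rw [h.map_top] at h1
    have h2 := smul_le_smul_of_nonneg_left h1 hK.le
    rw [smul_smul, mul_inv_cancel₀ hK.ne', one_smul, add_sub_right_comm,
      le_add_iff_nonneg_left, sub_nonneg] at h2
    exact h2
  have hlim : Tendsto (fun n : ℕ => b + (1 / ((n : ℝ) + 1)) • (1 : A)) atTop (𝓝 b) := by
    simpa using tendsto_const_nhds.add
      ((tendsto_one_div_add_atTop_nhds_zero_nat (𝕜 := ℝ)).smul_const (1 : A))
  exact ge_of_tendsto' hlim fun n => hε _ Nat.one_div_pos_of_nat

theorem isSigmaCPU_integralCP (h : IsPOVM μ) : IsSigmaCPU h.integralCP :=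
  ⟨h.integral_one, h.isSigmaNormal_integral⟩

theorem integral_star (h : IsPOVM μ) (f : Linf B) : h.integral (star f) = star (h.integral f) :=
  map_star (PositiveLinearMap.ofClass h.integralCP : Linf B →ₚ[ℂ] A) f

end IsPOVM

/-! ### Multiplicativity of the integral of a PVM -/

namespace IsPVM

variable {B : Type*} [BooleanAlgebra B] [IsBooleanSigmaAlgebra B] {A : Type*} [CStarAlgebra A]
  [PartialOrder A] [StarOrderedRing A] {μ : B → A}

/-- Density is used once in each variable. For fixed `chi q`, both sides are continuous and linear
in `f` and agree on every `chi p`; then `f` is fixed and `g` varies. -/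
theorem integral_mul (h : IsPVM μ) (f g : Linf B) :
    h.toIsPOVM.integral (f * g) = h.toIsPOVM.integral f * h.toIsPOVM.integral g := by
  set I := h.toIsPOVM.integral with hI
  have h1 : ∀ q, I ∘L (ContinuousLinearMap.mul ℂ (Linf B)).flip (Linf.chi q) =
      (ContinuousLinearMap.mul ℂ A).flip (I (Linf.chi q)) ∘L I := fun q =>
    Linf.eq_of_eq_chi fun p => by
      change I (Linf.chi p * Linf.chi q) = I (Linf.chi p) * I (Linf.chi q)
      rw [← Linf.chi_inf, hI, h.toIsPOVM.integral_chi, h.toIsPOVM.integral_chi,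
        h.toIsPOVM.integral_chi, h.map_inf]
  have h2 : I ∘L ContinuousLinearMap.mul ℂ (Linf B) f = ContinuousLinearMap.mul ℂ A (I f) ∘L I :=
    Linf.eq_of_eq_chi fun q => DFunLike.congr_fun (h1 q) f
  exact DFunLike.congr_fun h2 g

/-- The integral of a projection valued measure, as a star homomorphism. -/
def integralHom (h : IsPVM μ) : Linf B →⋆ₐ[ℂ] A where
  toAlgHom := AlgHom.ofLinearMap h.toIsPOVM.integral.toLinearMap h.toIsPOVM.integral_one
    h.integral_mul
  map_star' := h.toIsPOVM.integral_star

end IsPVM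

end PovmIntegration

end

theorem theorem4p17 {B : Type*} [BooleanAlgebra B] [IsBooleanSigmaAlgebra B]
    {A : Type*} [CStarAlgebra A] [PartialOrder A] [StarOrderedRing A] [IsSigmaCStarAlgebra A] :
    -- every POVM extends uniquely to a σ-cpu map, also among all positive maps
    (∀ μ : B → A, IsPOVM μ →
      (∃! φ : Linf B →CP A, IsSigmaCPU φ ∧ ∀ p, φ (Linf.chi p) = μ p) ∧
      (∀ (φ : Linf B →CP A) (ψ : Linf B →ₚ[ℂ] A), IsSigmaCPU φ → (∀ p, φ (Linf.chi p) = μ p) →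
        (∀ p, ψ (Linf.chi p) = μ p) → ∀ f, ψ f = φ f)) ∧
    -- conversely, every σ-cpu map restricts to a POVM
    (∀ φ : Linf B →CP A, IsSigmaCPU φ → IsPOVM fun p => φ (Linf.chi p)) ∧
    -- every PVM extends uniquely to a σ-homomorphism, also among all positive maps
    (∀ μ : B → A, IsPVM μ →
      (∃! φ : Linf B →⋆ₐ[ℂ] A, IsSigmaNormal φ ∧ ∀ p, φ (Linf.chi p) = μ p) ∧
      (∀ (φ : Linf B →⋆ₐ[ℂ] A) (ψ : Linf B →ₚ[ℂ] A), IsSigmaNormal φ →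
        (∀ p, φ (Linf.chi p) = μ p) → (∀ p, ψ (Linf.chi p) = μ p) → ∀ f, ψ f = φ f)) ∧
    -- conversely, every σ-homomorphism restricts to a PVM
    (∀ φ : Linf B →⋆ₐ[ℂ] A, IsSigmaNormal φ → IsPVM fun p => φ (Linf.chi p)) := by
  refine ⟨fun μ h => ⟨⟨h.integralCP, ⟨h.isSigmaCPU_integralCP, h.integral_chi⟩, ?_⟩, ?_⟩, ?_,
    fun μ h => ⟨⟨h.integralHom, ⟨h.toIsPOVM.isSigmaNormal_integral, h.toIsPOVM.integral_chi⟩, ?_⟩,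
      ?_⟩, ?_⟩
  · rintro φ ⟨-, hφ⟩
    exact DFunLike.ext _ _ (Linf.eq_of_positive_of_eq_chi fun p =>
      (hφ p).trans (h.integral_chi p).symm)
  · exact fun φ ψ _ hφ hψ => Linf.eq_of_positive_of_eq_chi fun p => (hψ p).trans (hφ p).symm
  · exact fun φ hφ => isPOVM_of_isSigmaNormal hφ.1 hφ.2
  · rintro φ ⟨-, hφ⟩
    -- A ⋆-homomorphism is positive, so uniqueness for positive maps applies to it as well.
    exact DFunLike.ext _ _ (Linf.eq_of_positive_of_eq_chi fun p =>
      (hφ p).trans (h.toIsPOVM.integral_chi p).symm)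
  · exact fun φ ψ _ hφ hψ => Linf.eq_of_positive_of_eq_chi fun p => (hψ p).trans (hφ p).symm
  · exact fun φ hφ =>
      { isPOVM_of_isSigmaNormal (map_one φ) hφ with
        map_inf := fun p q => by rw [Linf.chi_inf, map_mul] }
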